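/- Let $\mathcal A,\mathcal B,\mathcal C$ be extriangulated categories (in the sense of Nakaoka–Palu) with enough projectives and enough injectives which satisfy condition (WIC): if $gf$ is an inflation then so is $f$, and if $gf$ is a deflation then so is $g$. *Conventions.* For an extriangulated category $(\mathscr C,\mathbb E,\mathfrak s)$ as above put $\mathbb E^{n+1}(X,Y)=\mathbb E(\Omega^nX,Y)$ for $n\ge 0$, where $\Omega X$ is a syzygy of $X$, i.e. there is a conflation $\Omega X\to P\to X$ with $P$ projective. Subcategories are full and closed under isomorphisms and direct summands. For a subcategory $\mathscr T$ let ${}^{\perp}\mathscr T=\{X : \mathbb E^n(X,T)=0\ \forall n\ge1,\ T\in\mathscr T\}$, and let $\mathcal X_{\mathscr T}$ be the class of objects $N$ for which there are conflations $K^n\to T^n\to K^{n+1}$ $(n\ge0)$ with $K^0=N$, $T^n\in\mathscr T$ and $K^n\in{}^{\perp}\mathscr T$ for all $n\ge 0$. The subcategory $\mathscr T$ is *Wakamatsu-tilting* if $\mathbb E^n(T,T')=0$ for all $n\ge1$ and $T,T'\in\mathscr T$, and every projective object of $\mathscr C$ lies in $\mathcal X_{\mathscr T}$. A morphism is *compatible*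 if, whenever it is both an inflation and a deflation, it is an isomorphism. A sequence $X\xrightarrow{x}Y\xrightarrow{y}Z$ is *right exact* if $x=h_2h_1$ with $h_1:X\to K$ a compatible deflation and $K\xrightarrow{h_2}Y\xrightarrow{y}Z$ a conflation; *left exact* sequences are defined dually. An additive functor $F$ between extriangulated categories is *right exact* if it preserves compatible morphisms and right exact sequences, and if to every extension $\delta\in\mathbb E(Z,X)$ with $\mathfrak s(\delta)=[X\xrightarrow{x}Y\xrightarrow{y}Z]$ there are assigned an object $X'_\delta$, a compatible deflation $g_\delta:FX\to X'_\delta$ and an extension $\eta(\delta)\in\mathbb E(FZ,X'_\delta)$ with $\mathfrak s(\eta(\delta))=[X'_\delta\xrightarrow{f}FY\xrightarrow{Fy}FZ]$ and $Fx=fg_\delta$, naturally in $\delta$ (for every morphism of extensions $(a,c):\delta\to\delta'$ there is $a':X'_\delta\to X'_{\delta'}$ with $a'g_\delta=g_{\delta'}F(a)$ and $a'_*\eta(\delta)=F(c)^*\eta(\delta')$). *Left exact* functors are defined dually, and $F$ is *exact* if it is both left and right exact. A *recollement* $(\mathcal A,\mathcal B,\mathcal C)$ consists of exact functors $i_*:\mathcal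 A\to\mathcal B$, $j^*:\mathcal B\to\mathcal C$, right exact functors $i^*:\mathcal B\to\mathcal A$, $j_!:\mathcal C\to\mathcal B$ and left exact functors $i^!:\mathcal B\to\mathcal A$, $j_*:\mathcal C\to\mathcal B$ such that $i^*\dashv i_*\dashv i^!$ and $j_!\dashv j^*\dashv j_*$ are adjoint triples; the essential image of $i_*$ is $\operatorname{Ker}j^*$; $i_*,j_!,j_*$ are fully faithful; and for every $X\in\mathcal B$, with $\theta_X,\vartheta_X,\upsilon_X,\nu_X$ the adjunction morphisms, * there are $A\in\mathcal A$ and conflations $i_*i^!X\xrightarrow{\theta_X}X\xrightarrow{y_1}K$ and $K\xrightarrow{y_2}j_*j^*X\to i_*A$ with $y_2$ compatible and $y_2y_1=\vartheta_X$; * there are $A'\in\mathcal A$ and conflations $i_*A'\to j_!j^*X\xrightarrow{z_1}L$ and $L\xrightarrow{z_2}X\xrightarrow{\nu_X}i_*i^*X$ with $z_1$ compatible and $z_2z_1=\upsilon_X$. The recollement is *$\theta$-$\nu$-compatible* if $\theta_X$ and $\nu_X$ are compatible for all $X\in\mathcal B$. **Theorem.** Let $(\mathcal A,\mathcal B,\mathcal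 C)$ be a $\theta$-$\nu$-compatible recollement in which $i^!$ and $i^*$ are exact, and let $\mathcal X'$ and $\mathcal X''$ be Wakamatsu-tilting subcategories of $\mathcal A$ and $\mathcal C$, respectively. Then $$\mathcal X=\{X\in\mathcal B : i^!X\in\mathcal X',\ j^*X\in\mathcal X''\}$$ is a Wakamatsu-tilting subcategory of $\mathcal B$. -/

import Mathlib

open CategoryTheory CategoryTheory.Limits Opposite

universe w v u w₁ v₁ u₁ w₂ v₂ u₂ w₃ v₃ u₃

namespace Extri

section Extensions

variable {C : Type u} [Category.{v} C]

/-- The group `𝔼(Z, X)` of extensions of `Z` by `X`, for a bifunctor `𝔼 : Cᵒᵖ × C ⥤ Ab`. -/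
abbrev Extension (E : Cᵒᵖ ⥤ C ⥤ AddCommGrpCat.{w}) (Z X : C) : Type w :=
  ((E.obj (op Z)).obj X : Type w)

/-- `a_* δ`. -/
def pushforward (E : Cᵒᵖ ⥤ C ⥤ AddCommGrpCat.{w}) {Z X X' : C} (a : X ⟶ X')
    (δ : Extension E Z X) : Extension E Z X' :=
  ((E.obj (op Z)).map a) δ

/-- `c^* δ`. -/
def pullback (E : Cᵒᵖ ⥤ C ⥤ AddCommGrpCat.{w}) {Z' Z X : C} (c : Z' ⟶ Z)
    (δ : Extension E Z X) : Extension E Z' X :=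
  ((E.map c.op).app X) δ

/-- `(a, c)` is a morphism of extensions `δ ⟶ δ'`, i.e. `a_* δ = c^* δ'`. -/
def IsExtensionMorphism (E : Cᵒᵖ ⥤ C ⥤ AddCommGrpCat.{w}) {Z X Z' X' : C}
    (δ : Extension E Z X) (δ' : Extension E Z' X') (a : X ⟶ X') (c : Z ⟶ Z') : Prop :=
  pushforward E a δ = pullback E c δ'

/-- The direct sum `δ ⊕ δ'` in `𝔼(Z ⊕ Z', X ⊕ X')`. -/
noncomputable def extensionSum [Preadditive C] [HasBinaryBiproducts C]
    (E : Cᵒᵖ ⥤ C ⥤ AddCommGrpCat.{w}) {Z X Z' X' : C}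
    (δ : Extension E Z X) (δ' : Extension E Z' X') : Extension E (Z ⊞ Z') (X ⊞ X') :=
  pushforward E biprod.inl (pullback E biprod.fst δ) +
    pushforward E biprod.inr (pullback E biprod.snd δ')

end Extensions

/-- An extriangulated category `(C, 𝔼, 𝔰)` in the sense of Nakaoka and Palu.
The realization `𝔰`, which sends an extension `δ ∈ 𝔼(Z, X)` to an equivalence class of sequences
`X ⟶ Y ⟶ Z`, is encoded by the relation `Realizes δ x y`: "the sequence `(x, y)` lies in the class
`𝔰(δ)`".  The first three axioms about `Realizes` say that, for each `δ`, the sequences `(x, y)`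
with `Realizes δ x y` form exactly one equivalence class. -/
class ExtriangulatedCategory (C : Type u) [Category.{v} C] [Preadditive C] [HasZeroObject C]
    [HasBinaryBiproducts C] where
  /-- The bifunctor `𝔼`. -/
  E : Cᵒᵖ ⥤ C ⥤ AddCommGrpCat.{w}
  /-- (ET1) additivity in the second variable. -/
  pushforward_add : ∀ {Z X X' : C} (a b : X ⟶ X') (δ : Extension E Z X),
    pushforward E (a + b) δ = pushforward E a δ + pushforward E b δ
  /-- (ET1) additivity in the first variable. -/
  pullback_add : ∀ {Z' Z X : C} (a b : Z' ⟶ Z) (δ : Extension E Z X),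
    pullback E (a + b) δ = pullback E a δ + pullback E b δ
  /-- `Realizes δ x y` means `𝔰(δ) = [x, y]`. -/
  Realizes : ∀ {X Y Z : C}, Extension E Z X → (X ⟶ Y) → (Y ⟶ Z) → Prop
  exists_realizes : ∀ {X Z : C} (δ : Extension E Z X),
    ∃ (Y : C) (x : X ⟶ Y) (y : Y ⟶ Z), Realizes δ x y
  realizes_unique : ∀ {X Y Y' Z : C} (δ : Extension E Z X) (x : X ⟶ Y) (y : Y ⟶ Z)
    (x' : X ⟶ Y') (y' : Y' ⟶ Z), Realizes δ x y → Realizes δ x' y' →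
    ∃ b : Y ≅ Y', x ≫ b.hom = x' ∧ b.hom ≫ y' = y
  realizes_of_equiv : ∀ {X Y Y' Z : C} (δ : Extension E Z X) (x : X ⟶ Y) (y : Y ⟶ Z)
    (x' : X ⟶ Y') (y' : Y' ⟶ Z) (b : Y ≅ Y'), Realizes δ x y →
    x ≫ b.hom = x' → b.hom ≫ y' = y → Realizes δ x' y'
  /-- (ET2) `𝔰` is a realization of `𝔼`. -/
  realization : ∀ {X Y Z X' Y' Z' : C} (δ : Extension E Z X) (δ' : Extension E Z' X')
    (x : X ⟶ Y) (y : Y ⟶ Z) (x' : X' ⟶ Y') (y' : Y' ⟶ Z') (a : X ⟶ X') (c : Z ⟶ Z'),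
    Realizes δ x y → Realizes δ' x' y' → IsExtensionMorphism E δ δ' a c →
    ∃ b : Y ⟶ Y', x ≫ b = a ≫ x' ∧ y ≫ c = b ≫ y'
  /-- (ET2) the zero extension is realized by the split sequence. -/
  realizes_zero : ∀ X Z : C,
    Realizes (0 : Extension E Z X) (biprod.inl : X ⟶ X ⊞ Z) (biprod.snd : X ⊞ Z ⟶ Z)
  /-- (ET2) `𝔰` commutes with direct sums. -/
  realizes_sum : ∀ {X Y Z X' Y' Z' : C} (δ : Extension E Z X) (δ' : Extension E Z' X')
    (x : X ⟶ Y) (y : Y ⟶ Z) (x' : X' ⟶ Y') (y' : Y' ⟶ Z'),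
    Realizes δ x y → Realizes δ' x' y' →
    Realizes (extensionSum E δ δ') (biprod.map x x') (biprod.map y y')
  /-- (ET3) -/
  et3 : ∀ {X Y Z X' Y' Z' : C} (δ : Extension E Z X) (δ' : Extension E Z' X')
    (x : X ⟶ Y) (y : Y ⟶ Z) (x' : X' ⟶ Y') (y' : Y' ⟶ Z') (a : X ⟶ X') (b : Y ⟶ Y'),
    Realizes δ x y → Realizes δ' x' y' → x ≫ b = a ≫ x' →
    ∃ c : Z ⟶ Z', IsExtensionMorphism E δ δ' a c ∧ y ≫ c = b ≫ y'
  /-- (ET3)ᵒᵖ -/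
  et3_op : ∀ {X Y Z X' Y' Z' : C} (δ : Extension E Z X) (δ' : Extension E Z' X')
    (x : X ⟶ Y) (y : Y ⟶ Z) (x' : X' ⟶ Y') (y' : Y' ⟶ Z') (b : Y ⟶ Y') (c : Z ⟶ Z'),
    Realizes δ x y → Realizes δ' x' y' → y ≫ c = b ≫ y' →
    ∃ a : X ⟶ X', IsExtensionMorphism E δ δ' a c ∧ x ≫ b = a ≫ x'
  /-- (ET4) -/
  et4 : ∀ {X Y W D F : C} (δ : Extension E D X) (δ' : Extension E F Y)
    (f : X ⟶ Y) (f' : Y ⟶ D) (g : Y ⟶ W) (g' : W ⟶ F),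
    Realizes δ f f' → Realizes δ' g g' →
    ∃ (G : C) (h' : W ⟶ G) (d : D ⟶ G) (e : G ⟶ F) (δ'' : Extension E G X),
      Realizes δ'' (f ≫ g) h' ∧ f' ≫ d = g ≫ h' ∧ h' ≫ e = g' ∧
      Realizes (pushforward E f' δ') d e ∧
      pullback E d δ'' = δ ∧
      pushforward E f δ'' = pullback E e δ'
  /-- (ET4)ᵒᵖ -/
  et4_op : ∀ {X Y W D F : C} (δ : Extension E Y D) (δ' : Extension E W F)
    (f' : D ⟶ X) (f : X ⟶ Y) (g' : F ⟶ Y) (g : Y ⟶ W),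
    Realizes δ f' f → Realizes δ' g' g →
    ∃ (G : C) (h' : G ⟶ X) (d : D ⟶ G) (e : G ⟶ F) (δ'' : Extension E W G),
      Realizes δ'' h' (f ≫ g) ∧ e ≫ g' = h' ≫ f ∧ d ≫ h' = f' ∧
      Realizes (pullback E g' δ) d e ∧
      pushforward E e δ'' = δ' ∧
      pullback E g δ'' = pushforward E d δ

section Basic

variable {C : Type u} [Category.{v} C] [Preadditive C] [HasZeroObject C] [HasBinaryBiproducts C]
  [ExtriangulatedCategory.{w} C]

/-- The extension group `𝔼(Z, X)` of an extriangulated category. -/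
abbrev Ext1 (Z X : C) : Type w := Extension (ExtriangulatedCategory.E (C := C)) Z X

/-- `a_* δ` in an extriangulated category. -/
abbrev push {Z X X' : C} (a : X ⟶ X') (δ : Ext1 Z X) : Ext1 Z X' :=
  pushforward (ExtriangulatedCategory.E (C := C)) a δ

/-- `c^* δ` in an extriangulated category. -/
abbrev pull {Z' Z X : C} (c : Z' ⟶ Z) (δ : Ext1 Z X) : Ext1 Z' X :=
  pullback (ExtriangulatedCategory.E (C := C)) c δ

/-- `X ⟶ Y ⟶ Z ⇢ δ` is an `𝔼`-triangle. -/
def IsETriangle {X Y Z : C} (x : X ⟶ Y) (y : Y ⟶ Z) (δ : Ext1 Z X) : Prop :=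
  ExtriangulatedCategory.Realizes δ x y

def IsConflation {X Y Z : C} (x : X ⟶ Y) (y : Y ⟶ Z) : Prop :=
  ∃ δ : Ext1 Z X, IsETriangle x y δ

def IsInflation {X Y : C} (x : X ⟶ Y) : Prop :=
  ∃ (Z : C) (y : Y ⟶ Z), IsConflation x y

def IsDeflation {Y Z : C} (y : Y ⟶ Z) : Prop :=
  ∃ (X : C) (x : X ⟶ Y), IsConflation x y

/-- A projective object (relative to conflations). -/
def IsProjective (P : C) : Prop :=
  ∀ {X Y Z : C} (x : X ⟶ Y) (y : Y ⟶ Z), IsConflation x y →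
    ∀ f : P ⟶ Z, ∃ g : P ⟶ Y, g ≫ y = f

/-- An injective object (relative to conflations). -/
def IsInjective (I : C) : Prop :=
  ∀ {X Y Z : C} (x : X ⟶ Y) (y : Y ⟶ Z), IsConflation x y →
    ∀ f : X ⟶ I, ∃ g : Y ⟶ I, x ≫ g = f

/-- A morphism is compatible if, when it is both an inflation and a deflation, it is an
isomorphism. -/
def IsCompatible {X Y : C} (f : X ⟶ Y) : Prop :=
  IsInflation f → IsDeflation f → IsIso f

/-- `X ⟶ Y ⟶ Z` is a right exact `𝔼`-triangle. -/
def IsRightExactSeq {X Y Z : C} (x : X ⟶ Y) (y : Y ⟶ Z) : Prop :=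
  ∃ (K : C) (h₁ : X ⟶ K) (h₂ : K ⟶ Y),
    IsConflation h₂ y ∧ IsDeflation h₁ ∧ IsCompatible h₁ ∧ h₁ ≫ h₂ = x

/-- `X ⟶ Y ⟶ Z` is a left exact `𝔼`-triangle. -/
def IsLeftExactSeq {X Y Z : C} (x : X ⟶ Y) (y : Y ⟶ Z) : Prop :=
  ∃ (K : C) (h₁ : Y ⟶ K) (h₂ : K ⟶ Z),
    IsConflation x h₁ ∧ IsInflation h₂ ∧ IsCompatible h₂ ∧ h₁ ≫ h₂ = y

/-- A right exact 4-term `𝔼`-triangle sequence `X ⟶ Y ⟶ Z ⟶ W`. -/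
def IsRightExactFourTerm {X Y Z W : C} (x : X ⟶ Y) (y : Y ⟶ Z) (z : Z ⟶ W) : Prop :=
  ∃ (K : C) (y₁ : Y ⟶ K) (y₂ : K ⟶ Z),
    IsConflation x y₁ ∧ IsConflation y₂ z ∧ y₁ ≫ y₂ = y ∧ IsCompatible y₁

/-- A left exact 4-term `𝔼`-triangle sequence `X ⟶ Y ⟶ Z ⟶ W`. -/
def IsLeftExactFourTerm {X Y Z W : C} (x : X ⟶ Y) (y : Y ⟶ Z) (z : Z ⟶ W) : Prop :=
  ∃ (K : C) (y₁ : Y ⟶ K) (y₂ : K ⟶ Z),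
    IsConflation x y₁ ∧ IsConflation y₂ z ∧ y₁ ≫ y₂ = y ∧ IsCompatible y₂

end Basic

section Conditions

variable (C : Type u) [Category.{v} C] [Preadditive C] [HasZeroObject C] [HasBinaryBiproducts C]
  [ExtriangulatedCategory.{w} C]

class HasEnoughProjectives : Prop where
  exists_deflation : ∀ X : C, ∃ (P : C) (p : P ⟶ X), IsProjective P ∧ IsDeflation p

class HasEnoughInjectives : Prop where
  exists_inflation : ∀ X : C, ∃ (I : C) (i : X ⟶ I), IsInjective I ∧ IsInflation i

/-- Condition (WIC). -/
class IsWIC : Prop where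
  inflation_of_comp : ∀ {X Y Z : C} (f : X ⟶ Y) (g : Y ⟶ Z), IsInflation (f ≫ g) → IsInflation f
  deflation_of_comp : ∀ {X Y Z : C} (f : X ⟶ Y) (g : Y ⟶ Z), IsDeflation (f ≫ g) → IsDeflation g

end Conditions

section HigherExtensions

variable {C : Type u} [Category.{v} C] [Preadditive C] [HasZeroObject C] [HasBinaryBiproducts C]
  [ExtriangulatedCategory.{w} C]

theorem exists_syzygy [HasEnoughProjectives C] (X : C) :
    ∃ (K P : C) (k : K ⟶ P) (p : P ⟶ X), IsProjective P ∧ IsConflation k p := by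
  obtain ⟨P, p, hP, K, k, h⟩ := HasEnoughProjectives.exists_deflation X
  exact ⟨K, P, k, p, hP, h⟩

/-- A chosen syzygy `Ω X`. -/
noncomputable def syzygy [HasEnoughProjectives C] (X : C) : C := (exists_syzygy X).choose

/-- The higher extension group `𝔼ⁿ⁺¹(X, Y) = 𝔼(Ωⁿ X, Y)`; thus `n = 0` gives `𝔼(X, Y)`. -/
abbrev higherExt [HasEnoughProjectives C] (n : ℕ) (X Y : C) : Type w :=
  Ext1 (syzygy^[n] X) Y

/-- `𝔼ⁱ(X, Y) = 0` for all `i ≥ 1`. -/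
def ExtVanish [HasEnoughProjectives C] (X Y : C) : Prop :=
  ∀ n : ℕ, ∀ δ : higherExt n X Y, δ = 0

/-- The left orthogonal `^⊥ T`. -/
def leftPerp [HasEnoughProjectives C] (T : ObjectProperty C) : ObjectProperty C :=
  fun X => ∀ Y : C, T Y → ExtVanish X Y

/-- The subcategory `𝒳_T` of all `N` admitting an infinite `𝔼`-triangle sequence
`N ⟶ T⁰ ⟶ T¹ ⟶ ⋯` with all `Tⁿ` in `T`, obtained by splicing `𝔼`-triangles
`Kⁿ ⟶ Tⁿ ⟶ Kⁿ⁺¹` with `K⁰ = N` and all `Kⁿ` in `^⊥ T`. -/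
def coresolvedBy [HasEnoughProjectives C] (T : ObjectProperty C) : ObjectProperty C :=
  fun N => ∃ (K T' : ℕ → C) (g : ∀ n, K n ⟶ T' n) (f : ∀ n, T' n ⟶ K (n + 1)),
    K 0 = N ∧ (∀ n, IsConflation (g n) (f n)) ∧ (∀ n, leftPerp T (K n)) ∧ ∀ n, T (T' n)

/-- A Wakamatsu-tilting subcategory.  A (full) subcategory is given by its class of objects; it is
closed under isomorphisms and direct summands. -/
structure IsWakamatsuTilting [HasEnoughProjectives C] (T : ObjectProperty C) : Prop where
  closed_iso : ∀ {X Y : C}, (X ≅ Y) → T X → T Y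
  closed_summand : ∀ X Y : C, T (X ⊞ Y) → T X
  /-- (WT1) -/
  self_orthogonal : ∀ X Y : C, T X → T Y → ExtVanish X Y
  /-- (WT2) -/
  projective_coresolved : ∀ P : C, IsProjective P → coresolvedBy T P

end HigherExtensions

section Functors

variable {A : Type u₁} [Category.{v₁} A] [Preadditive A] [HasZeroObject A]
  [HasBinaryBiproducts A] [ExtriangulatedCategory.{w₁} A]
  {B : Type u₂} [Category.{v₂} B] [Preadditive B] [HasZeroObject B]
  [HasBinaryBiproducts B] [ExtriangulatedCategory.{w₂} B]

/-- A right exact functor between extriangulated categories.  In the last condition, each extension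
`δ ∈ 𝔼(Z, X)` with `𝔰(δ) = [x, y]` has an associated `𝔼`-triangle `X' ⟶ F Y ⟶ F Z ⇢ η(δ)` together
with a compatible deflation `F X ⟶ X'` through which `F x` factors.  The object `X'` depends on `δ`,
so naturality of `η` is expressed along the induced morphisms between the objects `X'`. -/
structure IsRightExactFunctor (F : A ⥤ B) : Prop where
  additive : F.Additive
  map_compatible : ∀ {X Y : A} (f : X ⟶ Y), IsCompatible f → IsCompatible (F.map f)
  map_rightExact : ∀ {X Y Z : A} (x : X ⟶ Y) (y : Y ⟶ Z),
    IsRightExactSeq x y → IsRightExactSeq (F.map x) (F.map y)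
  exists_natural : ∃ (X' : ∀ {Z X : A}, Ext1 Z X → B)
    (g : ∀ {Z X : A} (δ : Ext1 Z X), F.obj X ⟶ X' δ)
    (η : ∀ {Z X : A} (δ : Ext1 Z X), Ext1 (F.obj Z) (X' δ)),
    (∀ {Z X : A} (δ : Ext1 Z X), IsDeflation (g δ) ∧ IsCompatible (g δ)) ∧
    (∀ {X Y Z : A} (x : X ⟶ Y) (y : Y ⟶ Z) (δ : Ext1 Z X), IsETriangle x y δ →
      ∃ f : X' δ ⟶ F.obj Y, IsETriangle f (F.map y) (η δ) ∧ g δ ≫ f = F.map x) ∧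
    (∀ {Z₁ X₁ Z₂ X₂ : A} (δ₁ : Ext1 Z₁ X₁) (δ₂ : Ext1 Z₂ X₂) (a : X₁ ⟶ X₂) (c : Z₁ ⟶ Z₂),
      push a δ₁ = pull c δ₂ →
      ∃ a' : X' δ₁ ⟶ X' δ₂, g δ₁ ≫ a' = F.map a ≫ g δ₂ ∧
        push a' (η δ₁) = pull (F.map c) (η δ₂))

/-- A left exact functor between extriangulated categories (the dual notion): each extension
`δ ∈ 𝔼(Z, X)` with `𝔰(δ) = [x, y]` has an associated `𝔼`-triangle `F X ⟶ F Y ⟶ Z' ⇢ η(δ)` together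
with a compatible inflation `Z' ⟶ F Z` through which `F y` factors. -/
structure IsLeftExactFunctor (F : A ⥤ B) : Prop where
  additive : F.Additive
  map_compatible : ∀ {X Y : A} (f : X ⟶ Y), IsCompatible f → IsCompatible (F.map f)
  map_leftExact : ∀ {X Y Z : A} (x : X ⟶ Y) (y : Y ⟶ Z),
    IsLeftExactSeq x y → IsLeftExactSeq (F.map x) (F.map y)
  exists_natural : ∃ (Z' : ∀ {Z X : A}, Ext1 Z X → B)
    (h : ∀ {Z X : A} (δ : Ext1 Z X), Z' δ ⟶ F.obj Z)
    (η : ∀ {Z X : A} (δ : Ext1 Z X), Ext1 (Z' δ) (F.obj X)),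
    (∀ {Z X : A} (δ : Ext1 Z X), IsInflation (h δ) ∧ IsCompatible (h δ)) ∧
    (∀ {X Y Z : A} (x : X ⟶ Y) (y : Y ⟶ Z) (δ : Ext1 Z X), IsETriangle x y δ →
      ∃ f : F.obj Y ⟶ Z' δ, IsETriangle (F.map x) f (η δ) ∧ f ≫ h δ = F.map y) ∧
    (∀ {Z₁ X₁ Z₂ X₂ : A} (δ₁ : Ext1 Z₁ X₁) (δ₂ : Ext1 Z₂ X₂) (a : X₁ ⟶ X₂) (c : Z₁ ⟶ Z₂),
      push a δ₁ = pull c δ₂ →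
      ∃ c' : Z' δ₁ ⟶ Z' δ₂, c' ≫ h δ₂ = h δ₁ ≫ F.map c ∧
        push (F.map a) (η δ₁) = pull c' (η δ₂))

/-- An exact functor is one that is both right exact and left exact. -/
structure IsExactFunctor (F : A ⥤ B) : Prop where
  rightExact : IsRightExactFunctor F
  leftExact : IsLeftExactFunctor F

end Functors

section Recollements

variable (A : Type u₁) [Category.{v₁} A] [Preadditive A] [HasZeroObject A]
  [HasBinaryBiproducts A] [ExtriangulatedCategory.{w₁} A]
  (B : Type u₂) [Category.{v₂} B] [Preadditive B] [HasZeroObject B]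
  [HasBinaryBiproducts B] [ExtriangulatedCategory.{w₂} B]
  (C : Type u₃) [Category.{v₃} C] [Preadditive C] [HasZeroObject C]
  [HasBinaryBiproducts C] [ExtriangulatedCategory.{w₃} C]

/-- A recollement `(A, B, C)` of extriangulated categories. -/
structure Recollement where
  /-- `i^*` -/
  iUpperStar : B ⥤ A
  /-- `i_*` -/
  iLowerStar : A ⥤ B
  /-- `i^!` -/
  iUpperShriek : B ⥤ A
  /-- `j_!` -/
  jLowerShriek : C ⥤ B
  /-- `j^*` -/
  jUpperStar : B ⥤ C
  /-- `j_*` -/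
  jLowerStar : C ⥤ B
  iLowerStar_exact : IsExactFunctor iLowerStar
  jUpperStar_exact : IsExactFunctor jUpperStar
  iUpperStar_rightExact : IsRightExactFunctor iUpperStar
  jLowerShriek_rightExact : IsRightExactFunctor jLowerShriek
  iUpperShriek_leftExact : IsLeftExactFunctor iUpperShriek
  jLowerStar_leftExact : IsLeftExactFunctor jLowerStar
  /-- `i^* ⊣ i_*` -/
  adjI₁ : iUpperStar ⊣ iLowerStar
  /-- `i_* ⊣ i^!` -/
  adjI₂ : iLowerStar ⊣ iUpperShriek
  /-- `j_! ⊣ j^*` -/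
  adjJ₁ : jLowerShriek ⊣ jUpperStar
  /-- `j^* ⊣ j_*` -/
  adjJ₂ : jUpperStar ⊣ jLowerStar
  /-- `Im i_* = Ker j^*` -/
  essImage_eq_ker : ∀ Y : B, iLowerStar.essImage Y ↔ IsZero (jUpperStar.obj Y)
  iLowerStar_full : iLowerStar.Full
  iLowerStar_faithful : iLowerStar.Faithful
  jLowerShriek_full : jLowerShriek.Full
  jLowerShriek_faithful : jLowerShriek.Faithful
  jLowerStar_full : jLowerStar.Full
  jLowerStar_faithful : jLowerStar.Faithful
  /-- The left exact sequence `i_* i^! X ⟶ X ⟶ j_* j^* X ⟶ i_* A'`. -/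
  left_sequence : ∀ X : B, ∃ (A' : A) (z : jLowerStar.obj (jUpperStar.obj X) ⟶ iLowerStar.obj A'),
    IsLeftExactFourTerm (adjI₂.counit.app X : iLowerStar.obj (iUpperShriek.obj X) ⟶ X)
      (adjJ₂.unit.app X : X ⟶ jLowerStar.obj (jUpperStar.obj X)) z
  /-- The right exact sequence `i_* A' ⟶ j_! j^* X ⟶ X ⟶ i_* i^* X`. -/
  right_sequence : ∀ X : B,
    ∃ (A' : A) (x : iLowerStar.obj A' ⟶ jLowerShriek.obj (jUpperStar.obj X)),
    IsRightExactFourTerm x (adjJ₁.counit.app X : jLowerShriek.obj (jUpperStar.obj X) ⟶ X)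
      (adjI₁.unit.app X : X ⟶ iLowerStar.obj (iUpperStar.obj X))

variable {A B C}

/-- The recollement is `θ`-`ν`-compatible: the adjunction morphisms `θ_X : i_* i^! X ⟶ X` and
`ν_X : X ⟶ i_* i^* X` are compatible for all `X`. -/
def Recollement.IsThetaNuCompatible (R : Recollement A B C) : Prop :=
  ∀ X : B,
    IsCompatible (R.adjI₂.counit.app X : R.iLowerStar.obj (R.iUpperShriek.obj X) ⟶ X) ∧
    IsCompatible (R.adjI₁.unit.app X : X ⟶ R.iLowerStar.obj (R.iUpperStar.obj X))

/-- The glued subcategory `{X ∈ B : i^! X ∈ X', j^* X ∈ X''}`. -/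
def Recollement.glue (R : Recollement A B C) (X' : ObjectProperty A) (X'' : ObjectProperty C) :
    ObjectProperty B :=
  fun X => X' (R.iUpperShriek.obj X) ∧ X'' (R.jUpperStar.obj X)

end Recollements

end Extri

namespace Extri

open scoped ZeroObject

/-! The hypotheses force the recollement to split: every `X` in `B` is isomorphic to `i_* i^! X ⊕
j_* j^* X`, and `i^* ≅ i^!`. Tilting in `B` then separates into tilting in `A` and in `C`.

Exactness of `i^!` and `i^*` collapses the two four-term sequences of the recollement to conflations
`i_* i^! X ⟶ X ⟶ j_* j^* X` and `j_! j^* X ⟶ X ⟶ i_* i^* X`, and makes `j_*` preserve conflations.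
The crux is `i^! j_! = 0` (`isZero_iUpperShriek_jLowerShriek`), which comes from the behaviour of
compatible morphisms at `j_! V ⟶ 0`. It makes the unit `j_! V ⟶ j_* j^* j_! V` invertible, and by
naturality every unit `X ⟶ j_* j^* X` has a section (`exists_section_unit`).

The adjunctions `i^* ⊣ i_*` and `j^* ⊣ j_*` consist of conflation-preserving functors with fully
faithful right adjoints, so vanishing of higher extensions in `A` and `C` transfers to `B`
(`ExtVanish.of_adjunction`, `extVanish_of_extVanish`). The left adjoints preserve projectives, so a
projective `P` of `B` is coresolved by the direct sum of the images under `i_*` and `j_*` of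
coresolutions of `i^! P` and `j^* P`. -/

theorem isIso_id_add_of_sq_zero {C : Type u} [Category.{v} C] [Preadditive C] {X : C} (u : X ⟶ X)
    (hu : u ≫ u = 0) : IsIso (𝟙 X + u) :=
  ⟨𝟙 X - u, by simp [hu], by simp [hu]⟩

theorem isIso_of_isIso_comp {C : Type u} [Category.{v} C] {X Y : C} (f : X ⟶ Y) (g : Y ⟶ X)
    [IsIso (f ≫ g)] [IsIso (g ≫ f)] : IsIso f := by
  have h1 : f ≫ (g ≫ inv (f ≫ g)) = 𝟙 X := by rw [← Category.assoc, IsIso.hom_inv_id]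
  have h2 : (inv (g ≫ f) ≫ g) ≫ f = 𝟙 Y := by rw [Category.assoc, IsIso.inv_hom_id]
  have h3 : inv (g ≫ f) ≫ g = g ≫ inv (f ≫ g) := by
    rw [← Category.comp_id (inv (g ≫ f) ≫ g), ← h1, ← Category.assoc _ f, h2, Category.id_comp]
  exact ⟨_, h1, by rw [← h3, h2]⟩

/-! ### `𝔼`-triangles: exact sequences of `Hom` and `𝔼`, the five lemma. -/

section ETriangles

variable {C : Type u} [Category.{v} C] [Preadditive C] [HasZeroObject C] [HasBinaryBiproducts C]
  [ExtriangulatedCategory.{w} C]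

theorem push_id {Z X : C} (δ : Ext1 Z X) : push (𝟙 X) δ = δ := by
  simp [push, pushforward]

theorem push_comp {Z X X' X'' : C} (a : X ⟶ X') (b : X' ⟶ X'') (δ : Ext1 Z X) :
    push (a ≫ b) δ = push b (push a δ) := by
  simp [push, pushforward]

theorem pull_id {Z X : C} (δ : Ext1 Z X) : pull (𝟙 Z) δ = δ := by
  simp [pull, pullback]

theorem pull_comp {Z'' Z' Z X : C} (c : Z'' ⟶ Z') (d : Z' ⟶ Z) (δ : Ext1 Z X) :
    pull (c ≫ d) δ = pull c (pull d δ) := by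
  simp [pull, pullback]

theorem push_pull {Z' Z X X' : C} (a : X ⟶ X') (c : Z' ⟶ Z) (δ : Ext1 Z X) :
    push a (pull c δ) = pull c (push a δ) := by
  have h := ((ExtriangulatedCategory.E (C := C)).map c.op).naturality a
  exact (ConcreteCategory.congr_hom h δ).symm

theorem push_zero {Z X X' : C} (a : X ⟶ X') : push a (0 : Ext1 Z X) = 0 :=
  map_zero ((((ExtriangulatedCategory.E (C := C)).obj (op Z)).map a).hom)

theorem pull_zero {Z' Z X : C} (c : Z' ⟶ Z) : pull c (0 : Ext1 Z X) = 0 :=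
  map_zero ((((ExtriangulatedCategory.E (C := C)).map c.op).app X).hom)

theorem add_push {Z X X' : C} (a b : X ⟶ X') (δ : Ext1 Z X) :
    push (a + b) δ = push a δ + push b δ :=
  ExtriangulatedCategory.pushforward_add a b δ

theorem add_pull {Z' Z X : C} (a b : Z' ⟶ Z) (δ : Ext1 Z X) :
    pull (a + b) δ = pull a δ + pull b δ :=
  ExtriangulatedCategory.pullback_add a b δ

theorem zero_push {Z X X' : C} (δ : Ext1 Z X) : push (0 : X ⟶ X') δ = 0 := by
  have h := add_push (0 : X ⟶ X') 0 δ
  simpa using h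

theorem zero_pull {Z' Z X : C} (δ : Ext1 Z X) : pull (0 : Z' ⟶ Z) δ = 0 := by
  have h := add_pull (0 : Z' ⟶ Z) 0 δ
  simpa using h

theorem sub_push {Z X X' : C} (a b : X ⟶ X') (δ : Ext1 Z X) :
    push (a - b) δ = push a δ - push b δ := by
  rw [eq_sub_iff_add_eq, ← add_push, sub_add_cancel]

theorem ext_eq_zero_of_isZero_left {Z X : C} (h : IsZero Z) (δ : Ext1 Z X) : δ = 0 := by
  rw [← pull_id δ, h.eq_of_src (𝟙 Z) 0, zero_pull]

theorem ext_eq_zero_of_isZero_right {Z X : C} (h : IsZero X) (δ : Ext1 Z X) : δ = 0 := by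
  rw [← push_id δ, h.eq_of_src (𝟙 X) 0, zero_push]

/-- The middle term of an `𝔼`-triangle may be replaced along an isomorphism. -/
theorem IsETriangle.of_iso_middle {X Y Y' Z : C} {x : X ⟶ Y} {y : Y ⟶ Z} {δ : Ext1 Z X}
    (h : IsETriangle x y δ) (b : Y ≅ Y') : IsETriangle (x ≫ b.hom) (b.inv ≫ y) δ :=
  ExtriangulatedCategory.realizes_of_equiv δ x y _ _ b h rfl (by simp)

theorem IsConflation.of_iso_middle {X Y Y' Z : C} {x : X ⟶ Y} {y : Y ⟶ Z}
    (h : IsConflation x y) (b : Y ≅ Y') : IsConflation (x ≫ b.hom) (b.inv ≫ y) :=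
  h.imp fun _ hδ => hδ.of_iso_middle b

theorem isETriangle_inl_snd (X Z : C) :
    IsETriangle (biprod.inl : X ⟶ X ⊞ Z) (biprod.snd : X ⊞ Z ⟶ Z) 0 :=
  ExtriangulatedCategory.realizes_zero X Z

/-- `X ⟶ X ⟶ 0`. -/
theorem isETriangle_id_zero (X : C) {Z : C} (hZ : IsZero Z) (y : X ⟶ Z) :
    IsETriangle (𝟙 X) y (0 : Ext1 Z X) := by
  let b : X ⊞ Z ≅ X :=
    { hom := biprod.fst
      inv := biprod.inl
      hom_inv_id := by
        apply biprod.hom_ext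
        · simp
        · exact hZ.eq_of_tgt _ _ }
  exact ExtriangulatedCategory.realizes_of_equiv 0 _ _ _ _ b (isETriangle_inl_snd X Z)
    (by simp [b]) (hZ.eq_of_tgt _ _)

/-- `0 ⟶ Z ⟶ Z`. -/
theorem isETriangle_zero_id {X : C} (hX : IsZero X) (Z : C) (x : X ⟶ Z) :
    IsETriangle x (𝟙 Z) (0 : Ext1 Z X) := by
  let b : X ⊞ Z ≅ Z :=
    { hom := biprod.snd
      inv := biprod.inr
      hom_inv_id := by
        apply biprod.hom_ext
        · exact hX.eq_of_tgt _ _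
        · simp }
  exact ExtriangulatedCategory.realizes_of_equiv 0 _ _ _ _ b (isETriangle_inl_snd X Z)
    (hX.eq_of_src _ _) (by simp [b])

section

variable {X Y Z : C} {x : X ⟶ Y} {y : Y ⟶ Z} {δ : Ext1 Z X} (h : IsETriangle x y δ)
include h

/-- (ET3) against the trivial triangle `Y ⟶ Y ⟶ 0`. The lemmas that follow obtain the other
exactness statements mostly by comparison with trivial or split triangles. -/
theorem IsETriangle.push_self : push x δ = 0 := by
  obtain ⟨c, hc, -⟩ := ExtriangulatedCategory.et3 δ (0 : Ext1 (0 : C) Y) x y (𝟙 Y) 0 x (𝟙 Y) h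
    (isETriangle_id_zero Y (isZero_zero C) _) rfl
  exact hc.trans (pull_zero c)

theorem IsETriangle.pull_self : pull y δ = 0 := by
  obtain ⟨a, ha, -⟩ := ExtriangulatedCategory.et3_op (0 : Ext1 Y (0 : C)) δ 0 (𝟙 Y) x y (𝟙 Y) y
    (isETriangle_zero_id (isZero_zero C) Y _) h rfl
  exact (ha.symm.trans (push_zero a))

theorem IsETriangle.exists_lift {T : C} (f : T ⟶ Y) (hf : f ≫ y = 0) : ∃ a : T ⟶ X, a ≫ x = f := by
  obtain ⟨a, -, ha⟩ := ExtriangulatedCategory.et3_op (0 : Ext1 (0 : C) T) δ (𝟙 T) 0 x y f 0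
    (isETriangle_id_zero T (isZero_zero C) _) h (by simp [hf])
  exact ⟨a, by simpa using ha.symm⟩

theorem IsETriangle.exists_desc {T : C} (f : Y ⟶ T) (hf : x ≫ f = 0) : ∃ a : Z ⟶ T, y ≫ a = f := by
  obtain ⟨a, -, ha⟩ := ExtriangulatedCategory.et3 δ (0 : Ext1 T (0 : C)) x y 0 (𝟙 T) 0 f
    h (isETriangle_zero_id (isZero_zero C) T _) (by simp [hf])
  exact ⟨a, by simpa using ha⟩

theorem IsETriangle.comp_eq_zero : x ≫ y = 0 := by
  obtain ⟨a, -, ha⟩ := ExtriangulatedCategory.et3 (0 : Ext1 (0 : C) X) δ (𝟙 X) 0 x y (𝟙 X) x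
    (isETriangle_id_zero X (isZero_zero C) _) h rfl
  simpa using ha.symm

theorem IsETriangle.eq_zero_of_retraction (r : Y ⟶ X) (hr : x ≫ r = 𝟙 X) : δ = 0 := by
  rw [← push_id δ, ← hr, push_comp, h.push_self, push_zero]

theorem IsETriangle.eq_zero_of_section (s : Z ⟶ Y) (hs : s ≫ y = 𝟙 Z) : δ = 0 := by
  rw [← pull_id δ, ← hs, pull_comp, h.pull_self, pull_zero]

theorem IsETriangle.exists_lift_of_pull_eq_zero {T : C} (f : T ⟶ Z) (hf : pull f δ = 0) :
    ∃ g : T ⟶ Y, g ≫ y = f := by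
  obtain ⟨b, -, hb⟩ := ExtriangulatedCategory.realization (0 : Ext1 T X) δ _ _ x y (𝟙 X) f
    (isETriangle_inl_snd X T) h (by rw [IsExtensionMorphism]; exact (push_zero _).trans hf.symm)
  exact ⟨biprod.inr ≫ b, by simp [← hb]⟩

theorem IsETriangle.exists_desc_of_push_eq_zero {T : C} (f : X ⟶ T) (hf : push f δ = 0) :
    ∃ g : Y ⟶ T, x ≫ g = f := by
  obtain ⟨b, hb, -⟩ := ExtriangulatedCategory.realization δ (0 : Ext1 Z T) x y _ _ f (𝟙 Z)
    h (isETriangle_inl_snd T Z)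
    (by rw [IsExtensionMorphism]; exact hf.trans (pull_zero _).symm)
  exact ⟨b ≫ biprod.fst, by simp [reassoc_of% hb]⟩

theorem IsETriangle.exists_iso_biprod (hδ : δ = 0) :
    ∃ b : Y ≅ X ⊞ Z, x ≫ b.hom = biprod.inl ∧ b.hom ≫ biprod.snd = y := by
  subst hδ
  exact ExtriangulatedCategory.realizes_unique _ _ _ _ _ h (isETriangle_inl_snd X Z)

theorem IsETriangle.isZero_right [IsIso x] : IsZero Z := by
  have hδ := h.eq_zero_of_retraction (inv x) (by simp)
  obtain ⟨s, hs⟩ := h.exists_lift_of_pull_eq_zero (𝟙 Z) (by rw [hδ, pull_zero])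
  rw [IsZero.iff_id_eq_zero, ← hs, ← IsIso.inv_hom_id_assoc x y, h.comp_eq_zero, comp_zero,
    comp_zero]

theorem IsETriangle.isZero_left [IsIso y] : IsZero X := by
  have hδ := h.eq_zero_of_section (inv y) (by simp)
  obtain ⟨r, hr⟩ := h.exists_desc_of_push_eq_zero (𝟙 X) (by rw [hδ, push_zero])
  have hx : x = 0 := by rw [← cancel_mono y, h.comp_eq_zero, zero_comp]
  rw [IsZero.iff_id_eq_zero, ← hr, hx, zero_comp]

theorem IsETriangle.isIso_left (hZ : IsZero Z) : IsIso x := by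
  obtain ⟨r, hr⟩ := h.exists_desc_of_push_eq_zero (𝟙 X) (ext_eq_zero_of_isZero_left hZ _)
  obtain ⟨s, hs⟩ := h.exists_lift (𝟙 Y) (hZ.eq_of_tgt _ _)
  have : s = r := by rw [← Category.comp_id s, ← hr, reassoc_of% hs]
  exact ⟨r, hr, by rw [← this, hs]⟩

theorem IsETriangle.isIso_right (hX : IsZero X) : IsIso y := by
  obtain ⟨r, hr⟩ := h.exists_desc (𝟙 Y) (hX.eq_of_src _ _)
  obtain ⟨s, hs⟩ := h.exists_lift_of_pull_eq_zero (𝟙 Z) (ext_eq_zero_of_isZero_right hX _)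
  have : s = r := by rw [← Category.id_comp r, ← hs, Category.assoc, hr, Category.comp_id]
  exact ⟨r, hr, by rw [← this, hs]⟩

/-- Exactness of `Hom(X, T) ⟶ 𝔼(Z, T) ⟶ 𝔼(Y, T)`: since `y^* ε = 0`, `y` lifts to the middle term of
`ε`, and (ET3)ᵒᵖ gives the map on first terms. -/
theorem IsETriangle.exists_push_eq {T : C} (ε : Ext1 Z T) (hε : pull y ε = 0) :
    ∃ a : X ⟶ T, push a δ = ε := by
  obtain ⟨N, t, n, ht⟩ := ExtriangulatedCategory.exists_realizes ε
  obtain ⟨g, hg⟩ := IsETriangle.exists_lift_of_pull_eq_zero ht y hε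
  obtain ⟨a, ha, -⟩ := ExtriangulatedCategory.et3_op δ ε x y t n g (𝟙 Z) h ht (by simp [hg])
  exact ⟨a, ha.trans (pull_id ε)⟩

end

/-- The difference `b - 𝟙` factors through `x` and is killed by precomposition with `x`, so its
square is zero. -/
theorem IsETriangle.isIso_of_comp {X Y Z : C} {x : X ⟶ Y} {y : Y ⟶ Z} {δ : Ext1 Z X}
    (h : IsETriangle x y δ) (b : Y ⟶ Y) (hx : x ≫ b = x) (hy : b ≫ y = y) : IsIso b := by
  obtain ⟨s, hs⟩ := h.exists_lift (b - 𝟙 Y) (by simp [hy])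
  have hu : (b - 𝟙 Y) ≫ (b - 𝟙 Y) = 0 := by
    rw [← hs, Category.assoc, hs, Preadditive.comp_sub, hx, Category.comp_id, sub_self, comp_zero]
  have := isIso_id_add_of_sq_zero _ hu
  simpa using this

/-- The five lemma for the middle term. -/
theorem IsETriangle.exists_iso_middle {X Y Z X' Y' Z' : C} {x : X ⟶ Y} {y : Y ⟶ Z} {δ : Ext1 Z X}
    {x' : X' ⟶ Y'} {y' : Y' ⟶ Z'} {δ' : Ext1 Z' X'} (h : IsETriangle x y δ)
    (h' : IsETriangle x' y' δ') (a : X ≅ X') (c : Z ≅ Z') (hac : push a.hom δ = pull c.hom δ') :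
    ∃ b : Y ≅ Y', x ≫ b.hom = a.hom ≫ x' ∧ b.hom ≫ y' = y ≫ c.hom := by
  obtain ⟨b, hb₁, hb₂⟩ := ExtriangulatedCategory.realization δ δ' x y x' y' a.hom c.hom h h' hac
  have hac' : push a.inv δ' = pull c.inv δ := by
    have := congrArg (fun ε => push a.inv (pull c.inv ε)) hac
    simp only [← pull_comp, ← push_pull] at this
    rw [← push_comp] at this
    simpa [push_id, pull_id] using this.symm
  obtain ⟨b', hb₁', hb₂'⟩ :=
    ExtriangulatedCategory.realization δ' δ x' y' x y a.inv c.inv h' h hac'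
  have : IsIso (b ≫ b') := h.isIso_of_comp _ (by rw [reassoc_of% hb₁, hb₁']; simp)
    (by rw [Category.assoc, ← hb₂', ← reassoc_of% hb₂]; simp)
  have : IsIso (b' ≫ b) := h'.isIso_of_comp _ (by rw [reassoc_of% hb₁', hb₁]; simp)
    (by rw [Category.assoc, ← hb₂, ← reassoc_of% hb₂']; simp)
  have := isIso_of_isIso_comp b b'
  exact ⟨asIso b, hb₁, hb₂.symm⟩

/-- Replacing an end term is not among the axioms: the transported extension is realized anew and
compared by the five lemma. -/
theorem IsConflation.of_iso_right {X Y Z Z' : C} {x : X ⟶ Y} {y : Y ⟶ Z} (h : IsConflation x y)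
    (c : Z ≅ Z') : IsConflation x (y ≫ c.hom) := by
  obtain ⟨δ, hδ⟩ := h
  obtain ⟨N, t, n, ht⟩ := ExtriangulatedCategory.exists_realizes (pull c.inv δ)
  obtain ⟨b, hb₁, hb₂⟩ := IsETriangle.exists_iso_middle hδ ht (Iso.refl X) c
    (by rw [← pull_comp]; simp [push_id, pull_id])
  refine ⟨pull c.inv δ, ?_⟩
  have := IsETriangle.of_iso_middle ht b.symm
  rw [← hb₂]
  convert this using 1
  · rw [← cancel_mono b.hom]
    simp [hb₁]
  · rfl

theorem IsConflation.of_iso_left {X' X Y Z : C} {x : X ⟶ Y} {y : Y ⟶ Z} (h : IsConflation x y)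
    (a : X' ≅ X) : IsConflation (a.hom ≫ x) y := by
  obtain ⟨δ, hδ⟩ := h
  obtain ⟨N, t, n, ht⟩ := ExtriangulatedCategory.exists_realizes (push a.inv δ)
  obtain ⟨b, hb₁, hb₂⟩ := IsETriangle.exists_iso_middle hδ ht a.symm (Iso.refl Z)
    (by simp [pull_id])
  refine ⟨push a.inv δ, ?_⟩
  have := IsETriangle.of_iso_middle ht b.symm
  convert this using 1
  · rw [← cancel_mono b.hom]
    simp [hb₁]
  · simp [hb₂]

end ETriangles

/-! ### Homotopy pullbacks and closure properties of conflations. -/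

section Conflations

variable {C : Type u} [Category.{v} C] [Preadditive C] [HasZeroObject C] [HasBinaryBiproducts C]
  [ExtriangulatedCategory.{w} C]

/-- Given conflations `X₁ ⟶ Y₁ ⟶ Z` and `X₂ ⟶ Y₂ ⟶ Z`, the homotopy pullback `M` of `Y₁` and `Y₂`
over `Z` sits in conflations `X₁ ⟶ M ⟶ Y₂` and `X₂ ⟶ M ⟶ Y₁`. -/
theorem IsETriangle.exists_homotopy_pullback {X₁ Y₁ X₂ Y₂ Z : C} {x₁ : X₁ ⟶ Y₁} {y₁ : Y₁ ⟶ Z}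
    {δ₁ : Ext1 Z X₁} {x₂ : X₂ ⟶ Y₂} {y₂ : Y₂ ⟶ Z} {δ₂ : Ext1 Z X₂} (h₁ : IsETriangle x₁ y₁ δ₁)
    (h₂ : IsETriangle x₂ y₂ δ₂) :
    ∃ (M : C) (m₁ : X₁ ⟶ M) (e₁ : M ⟶ Y₂) (m₂ : X₂ ⟶ M) (e₂ : M ⟶ Y₁),
      IsConflation m₁ e₁ ∧ IsConflation m₂ e₂ ∧ m₁ ≫ e₂ = x₁ ∧ m₂ ≫ e₁ = x₂ := by
  obtain ⟨M, m₁, e₁, hM⟩ := ExtriangulatedCategory.exists_realizes (pull y₂ δ₁)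
  -- `G` is the kernel term of the composite `M ⟶ Y₂ ⟶ Z`, an extension of `X₂` by `X₁` that splits
  -- because `x₂ ≫ y₂ = 0`.
  obtain ⟨G, h', d, e, δ'', hG, he, hd, hde, hpush, hpull⟩ :=
    ExtriangulatedCategory.et4_op (pull y₂ δ₁) δ₂ m₁ e₁ x₂ y₂ hM h₂
  change push e δ'' = δ₂ at hpush
  change pull y₂ δ'' = push d (pull y₂ δ₁) at hpull
  have hzero : pull x₂ (pull y₂ δ₁) = 0 := by
    rw [← pull_comp, h₂.comp_eq_zero, zero_pull]
  have hde' : IsETriangle d e (pull x₂ (pull y₂ δ₁)) := hde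
  rw [hzero] at hde'
  obtain ⟨r, hr⟩ := hde'.exists_desc_of_push_eq_zero (𝟙 X₁) (push_zero _)
  -- An arbitrary retraction `r` of `d` carries `δ''` to `δ₁` only up to a class `φ_* δ₂`;
  -- subtracting `e ≫ φ` from `r` removes this error and keeps a retraction.
  have hdiff : pull y₂ (push r δ'' - δ₁) = 0 := by
    have : pull y₂ (push r δ'') = pull y₂ δ₁ := by
      rw [← push_pull, hpull, ← push_comp, hr, push_id]
    have hsub : pull y₂ (push r δ'' - δ₁) = pull y₂ (push r δ'') - pull y₂ δ₁ :=
      map_sub ((((ExtriangulatedCategory.E (C := C)).map y₂.op).app X₁).hom) _ _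
    rw [hsub, this, sub_self]
  obtain ⟨φ, hφ⟩ := h₂.exists_push_eq _ hdiff
  have hrδ : push (r - e ≫ φ) δ'' = δ₁ := by
    rw [sub_push, push_comp, hpush, hφ, sub_sub_cancel]
  have hdr : d ≫ (r - e ≫ φ) = 𝟙 X₁ := by
    rw [Preadditive.comp_sub, hr, ← Category.assoc, hde'.comp_eq_zero, zero_comp, sub_zero]
  generalize r - e ≫ φ = r' at hrδ hdr
  -- the section of `e` complementary to `r'`
  obtain ⟨s, hs⟩ := hde'.exists_desc (𝟙 G - r' ≫ d) (by
    rw [Preadditive.comp_sub, ← Category.assoc, hdr, Category.id_comp, Category.comp_id, sub_self])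
  obtain ⟨s₀, hs₀⟩ := hde'.exists_lift_of_pull_eq_zero (𝟙 X₂) (pull_zero _)
  have hse : s ≫ e = 𝟙 X₂ := by
    have : e ≫ s ≫ e = e := by
      rw [← Category.assoc, hs, Preadditive.sub_comp, Category.assoc, hde'.comp_eq_zero,
        comp_zero, sub_zero, Category.id_comp]
    rw [← Category.id_comp (s ≫ e), ← hs₀, Category.assoc, this]
  have hsr : s ≫ r' = 0 := by
    have : e ≫ s ≫ r' = 0 := by
      rw [← Category.assoc, hs, Preadditive.sub_comp, Category.assoc, hdr, Category.comp_id,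
        Category.id_comp, sub_self]
    rw [← Category.id_comp (s ≫ r'), ← hs₀, Category.assoc, this, comp_zero]
  have hsplit : IsETriangle s r' 0 := by
    let b : X₂ ⊞ X₁ ≅ G :=
      { hom := biprod.desc s d
        inv := biprod.lift e r'
        hom_inv_id := by
          ext <;> simp [hse, hsr, hdr, hde'.comp_eq_zero]
        inv_hom_id := by
          rw [biprod.lift_desc, hs, sub_add_cancel] }
    exact ExtriangulatedCategory.realizes_of_equiv 0 _ _ _ _ b (isETriangle_inl_snd X₂ X₁)
      (by simp [b]) (by
        ext <;> simp [b, hsr, hdr])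
  -- The third term of the conflation starting with `X₂ ⟶ G ⟶ M` realizes `r'_* δ'' = δ₁`, hence is
  -- `Y₁` up to isomorphism.
  obtain ⟨G₂, h'', d₂, e₂, δ₃, h₃, hrd, -, hde₂, -, -⟩ :=
    ExtriangulatedCategory.et4 0 δ'' s r' h' (e₁ ≫ y₂) hsplit hG
  change IsETriangle d₂ e₂ (push r' δ'') at hde₂
  rw [hrδ] at hde₂
  obtain ⟨b, hb, -⟩ := ExtriangulatedCategory.realizes_unique _ _ _ _ _ hde₂ h₁
  refine ⟨M, m₁, e₁, s ≫ h', h'' ≫ b.hom, ⟨_, hM⟩, IsConflation.of_iso_right ⟨_, h₃⟩ b, ?_, ?_⟩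
  · rw [← hd, Category.assoc, ← reassoc_of% hrd, reassoc_of% hdr, hb]
  · rw [Category.assoc, ← he, ← Category.assoc, hse, Category.id_comp]

theorem IsConflation.isZero_right {X Y Z : C} {x : X ⟶ Y} {y : Y ⟶ Z} (h : IsConflation x y)
    (hx : IsIso x) : IsZero Z :=
  h.elim fun _ hδ => hδ.isZero_right

theorem IsConflation.isZero_left {X Y Z : C} {x : X ⟶ Y} {y : Y ⟶ Z} (h : IsConflation x y)
    (hy : IsIso y) : IsZero X :=
  h.elim fun _ hδ => hδ.isZero_left

theorem IsConflation.isIso_left {X Y Z : C} {x : X ⟶ Y} {y : Y ⟶ Z} (h : IsConflation x y)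
    (hZ : IsZero Z) : IsIso x :=
  h.elim fun _ hδ => hδ.isIso_left hZ

theorem IsConflation.isIso_right {X Y Z : C} {x : X ⟶ Y} {y : Y ⟶ Z} (h : IsConflation x y)
    (hX : IsZero X) : IsIso y :=
  h.elim fun _ hδ => hδ.isIso_right hX

theorem isDeflation_of_isZero {X Z : C} (hZ : IsZero Z) (f : X ⟶ Z) : IsDeflation f :=
  ⟨X, 𝟙 X, 0, isETriangle_id_zero X hZ f⟩

theorem IsInflation.comp_iso {X Y Y' : C} {f : X ⟶ Y} (h : IsInflation f) (b : Y ≅ Y') :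
    IsInflation (f ≫ b.hom) :=
  let ⟨Z, y, hy⟩ := h
  ⟨Z, b.inv ≫ y, hy.of_iso_middle b⟩

theorem IsInflation.iso_comp {X' X Y : C} {f : X ⟶ Y} (h : IsInflation f) (a : X' ≅ X) :
    IsInflation (a.hom ≫ f) :=
  let ⟨Z, y, hy⟩ := h
  ⟨Z, y, hy.of_iso_left a⟩

theorem IsDeflation.comp_iso {Y Z Z' : C} {f : Y ⟶ Z} (h : IsDeflation f) (c : Z ≅ Z') :
    IsDeflation (f ≫ c.hom) :=
  let ⟨X, x, hx⟩ := h
  ⟨X, x, hx.of_iso_right c⟩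

theorem IsDeflation.iso_comp {Y' Y Z : C} {f : Y ⟶ Z} (h : IsDeflation f) (b : Y' ≅ Y) :
    IsDeflation (b.hom ≫ f) :=
  let ⟨X, x, hx⟩ := h
  ⟨X, x ≫ b.inv, hx.of_iso_middle b.symm⟩

theorem IsConflation.biprod {X Y Z X' Y' Z' : C} {x : X ⟶ Y} {y : Y ⟶ Z} {x' : X' ⟶ Y'}
    {y' : Y' ⟶ Z'} (h : IsConflation x y) (h' : IsConflation x' y') :
    IsConflation (biprod.map x x') (biprod.map y y') :=
  let ⟨_, hδ⟩ := h
  let ⟨_, hδ'⟩ := h'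
  ⟨_, ExtriangulatedCategory.realizes_sum _ _ _ _ _ _ hδ hδ'⟩

end Conflations

/-! ### Dimension shifting and independence of the choice of syzygies. -/

section Projectives

variable {C : Type u} [Category.{v} C] [Preadditive C] [HasZeroObject C] [HasBinaryBiproducts C]
  [ExtriangulatedCategory.{w} C]

theorem IsProjective.ext_eq_zero {P : C} (hP : IsProjective P) {X : C} (δ : Ext1 P X) : δ = 0 := by
  obtain ⟨Y, x, y, h⟩ := ExtriangulatedCategory.exists_realizes δ
  obtain ⟨s, hs⟩ := hP x y ⟨δ, h⟩ (𝟙 P)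
  exact IsETriangle.eq_zero_of_section h s hs

theorem IsProjective.of_iso {P Q : C} (hP : IsProjective P) (e : P ≅ Q) : IsProjective Q := by
  intro X Y Z x y h f
  obtain ⟨g, hg⟩ := hP x y h (e.hom ≫ f)
  exact ⟨e.inv ≫ g, by simp [hg]⟩

theorem IsProjective.biprod {P Q : C} (hP : IsProjective P) (hQ : IsProjective Q) :
    IsProjective (P ⊞ Q) := by
  intro X Y Z x y h f
  obtain ⟨g, hg⟩ := hP x y h (biprod.inl ≫ f)
  obtain ⟨g', hg'⟩ := hQ x y h (biprod.inr ≫ f)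
  exact ⟨biprod.desc g g', by ext <;> simp [hg, hg']⟩

/-- Schanuel's lemma. -/
theorem exists_iso_biprod_of_isProjective {K P K' P' X : C} {k : K ⟶ P} {p : P ⟶ X} {k' : K' ⟶ P'}
    {p' : P' ⟶ X} (h : IsConflation k p) (h' : IsConflation k' p') (hP : IsProjective P)
    (hP' : IsProjective P') : Nonempty (K ⊞ P' ≅ K' ⊞ P) := by
  obtain ⟨δ, hδ⟩ := h
  obtain ⟨δ', hδ'⟩ := h'
  obtain ⟨M, m₁, e₁, m₂, e₂, ⟨ε₁, h₁⟩, ⟨ε₂, h₂⟩, -, -⟩ := hδ.exists_homotopy_pullback hδ'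
  obtain ⟨b₁, -⟩ := h₁.exists_iso_biprod (hP'.ext_eq_zero ε₁)
  obtain ⟨b₂, -⟩ := h₂.exists_iso_biprod (hP.ext_eq_zero ε₂)
  exact ⟨b₁.symm ≪≫ b₂⟩

/-- `𝔼ⁿ⁺¹(X, Y) = 0`, computed with some choice of `n` successive syzygies of `X`. -/
def ExtVanishAt (Y : C) : ℕ → C → Prop
  | 0, X => ∀ δ : Ext1 X Y, δ = 0
  | n + 1, X => ∃ (K P : C) (k : K ⟶ P) (p : P ⟶ X),
      IsProjective P ∧ IsConflation k p ∧ ExtVanishAt Y n K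

theorem ext_vanish_of_biprod_iso {X X' P' Y : C} (hP' : IsProjective P') {T : C}
    (hX : ∀ δ : Ext1 X Y, δ = 0) (e : X ⊞ P' ≅ X' ⊞ T) (δ : Ext1 X' Y) : δ = 0 := by
  have hsum : pull (𝟙 X') δ = pull (biprod.inl ≫ e.inv ≫ e.hom ≫ biprod.fst) δ := by simp
  -- The identity of `X'` factors through `X ⊞ P'`, so `δ` is a sum of one class pulled back through
  -- `X` and one through `P'`; both vanish.
  have hid : e.hom = biprod.fst ≫ biprod.inl ≫ e.hom + biprod.snd ≫ biprod.inr ≫ e.hom := by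
    ext <;> simp
  rw [pull_id] at hsum
  rw [hsum, hid]
  simp only [Preadditive.add_comp, Preadditive.comp_add, add_pull]
  simp only [pull_comp]
  rw [hX (pull biprod.inl (pull e.hom (pull biprod.fst δ))),
    hP'.ext_eq_zero (pull biprod.inr (pull e.hom (pull biprod.fst δ)))]
  simp [pull_zero]

/-- The vanishing of higher extensions is invariant under projective equivalence. -/
theorem ExtVanishAt.of_biprod_iso [HasEnoughProjectives C] {Y : C} {n : ℕ} :
    ∀ {X X' P P' : C}, IsProjective P → IsProjective P' → (X ⊞ P' ≅ X' ⊞ P) →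
      ExtVanishAt Y n X → ExtVanishAt Y n X' := by
  induction n with
  | zero => exact fun _ hP' e hX => ext_vanish_of_biprod_iso hP' hX e
  | succ n ih =>
    rintro X X' P P' hP hP' e ⟨K, Q, k, q, hQ, hkq, hK⟩
    obtain ⟨K', Q', k', q', hQ', hkq'⟩ := exists_syzygy X'
    refine ⟨K', Q', k', q', hQ', hkq', ?_⟩
    -- Adding `0 ⟶ P' ⟶ P'` and `0 ⟶ P ⟶ P` gives both syzygy conflations the same right-hand term,
    -- so that Schanuel's lemma applies.
    have h₁ := (hkq.biprod ⟨0, isETriangle_zero_id (isZero_zero C) P' 0⟩).of_iso_right e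
    have h₂ := hkq'.biprod ⟨0, isETriangle_zero_id (isZero_zero C) P 0⟩
    obtain ⟨f⟩ := exists_iso_biprod_of_isProjective h₁ h₂ (hQ.biprod hP') (hQ'.biprod hP)
    have b : ∀ W : C, W ⊞ (0 : C) ≅ W := fun W =>
      { hom := biprod.fst
        inv := biprod.inl
        hom_inv_id := by
          apply biprod.hom_ext
          · simp
          · exact (isZero_zero C).eq_of_tgt _ _ }
    exact ih (hQ.biprod hP') (hQ'.biprod hP)
      (biprod.mapIso (b K).symm (Iso.refl _) ≪≫ f ≪≫ biprod.mapIso (b K') (Iso.refl _)) hK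

theorem ExtVanishAt.of_iso [HasEnoughProjectives C] {X X' Y : C} {n : ℕ} (h : ExtVanishAt Y n X)
    (e : X ≅ X') : ExtVanishAt Y n X' := by
  obtain ⟨_, P, _, _, hP, _⟩ := exists_syzygy X
  exact h.of_biprod_iso hP hP (biprod.mapIso e (Iso.refl P))

theorem ExtVanishAt.of_iso_right {X Y Y' : C} {n : ℕ} (h : ExtVanishAt Y n X) (e : Y ≅ Y') :
    ExtVanishAt Y' n X := by
  induction n generalizing X with
  | zero =>
    intro δ
    have : δ = push e.hom (push e.inv δ) := by rw [← push_comp]; simp [push_id]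
    rw [this, h (push e.inv δ), push_zero]
  | succ n ih =>
    obtain ⟨K, P, k, p, hP, hkp, hK⟩ := h
    exact ⟨K, P, k, p, hP, hkp, ih hK⟩

theorem ExtVanishAt.of_conflation [HasEnoughProjectives C] {X Y K P : C} {n : ℕ}
    (h : ExtVanishAt Y (n + 1) X) {k : K ⟶ P} {p : P ⟶ X} (hP : IsProjective P)
    (hkp : IsConflation k p) : ExtVanishAt Y n K := by
  obtain ⟨K', P', k', p', hP', hkp', hK'⟩ := h
  obtain ⟨f⟩ := exists_iso_biprod_of_isProjective hkp' hkp hP' hP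
  exact hK'.of_biprod_iso hP' hP f

theorem exists_conflation_syzygy [HasEnoughProjectives C] (X : C) :
    ∃ (P : C) (k : syzygy X ⟶ P) (p : P ⟶ X), IsProjective P ∧ IsConflation k p :=
  (exists_syzygy X).choose_spec

/-- `syzygy^[n + 1] X` unfolds to `syzygy^[n] (syzygy X)`, which matches the recursion of
`ExtVanishAt`. -/
theorem extVanishAt_iff [HasEnoughProjectives C] {X Y : C} {n : ℕ} :
    ExtVanishAt Y n X ↔ ∀ δ : higherExt n X Y, δ = 0 := by
  induction n generalizing X with
  | zero => exact Iff.rfl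
  | succ n ih =>
    obtain ⟨P, k, p, hP, hkp⟩ := exists_conflation_syzygy X
    refine Iff.trans ⟨fun h => h.of_conflation hP hkp, fun h => ⟨_, P, k, p, hP, hkp, h⟩⟩ ih

theorem extVanish_iff [HasEnoughProjectives C] {X Y : C} :
    ExtVanish X Y ↔ ∀ n, ExtVanishAt Y n X :=
  forall_congr' fun _ => extVanishAt_iff.symm

theorem ExtVanish.of_iso [HasEnoughProjectives C] {X X' Y Y' : C} (h : ExtVanish X Y)
    (e : X ≅ X') (f : Y ≅ Y') : ExtVanish X' Y' := by
  rw [extVanish_iff] at h ⊢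
  exact fun n => ((h n).of_iso e).of_iso_right f

end Projectives

/-! ### Isomorphism invariance of coresolutions. -/

section CoresolvedBy

variable {C : Type u} [Category.{v} C] [Preadditive C] [HasZeroObject C] [HasBinaryBiproducts C]
  [ExtriangulatedCategory.{w} C] [HasEnoughProjectives C]

theorem coresolvedBy.of_iso {T : ObjectProperty C} {X X' : C} (h : coresolvedBy T X) (e : X ≅ X') :
    coresolvedBy T X' := by
  obtain ⟨K, T', g, f, rfl, hgf, hK, hT⟩ := h
  refine ⟨fun | 0 => X' | n + 1 => K (n + 1), T', fun | 0 => e.inv ≫ g 0 | n + 1 => g (n + 1),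
    f, rfl, ?_, ?_, hT⟩
  · rintro (_ | n)
    · exact (hgf 0).of_iso_left e.symm
    · exact hgf (n + 1)
  · rintro (_ | n)
    · exact fun Y hY => (hK 0 Y hY).of_iso e (Iso.refl Y)
    · exact hK (n + 1)

end CoresolvedBy

/-! ### Exact functors, adjunctions and vanishing of extensions. -/

section Functors

variable {A : Type u₁} [Category.{v₁} A] [Preadditive A] [HasZeroObject A]
  [HasBinaryBiproducts A] [ExtriangulatedCategory.{w₁} A]
  {B : Type u₂} [Category.{v₂} B] [Preadditive B] [HasZeroObject B]
  [HasBinaryBiproducts B] [ExtriangulatedCategory.{w₂} B]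

/-- The functor `F` sends conflations to conflations. -/
def PreservesConflations (F : A ⥤ B) : Prop :=
  ∀ ⦃X Y Z : A⦄ (x : X ⟶ Y) (y : Y ⟶ Z), IsConflation x y → IsConflation (F.map x) (F.map y)

/-- Right exactness factors `F x` through a compatible deflation `g δ`. Left exactness makes `F x`
an inflation, so by (WIC) `g δ` is one too, hence an isomorphism. -/
theorem IsExactFunctor.preservesConflations [IsWIC B] {F : A ⥤ B} (hF : IsExactFunctor F) :
    PreservesConflations F := by
  rintro X Y Z x y ⟨δ, hδ⟩
  obtain ⟨X', g, η, hg, hη, -⟩ := hF.rightExact.exists_natural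
  obtain ⟨Z', h, η', -, hη', -⟩ := hF.leftExact.exists_natural
  obtain ⟨f, hf, hgf⟩ := hη x y δ hδ
  obtain ⟨f', hf', -⟩ := hη' x y δ hδ
  have hinfl : IsInflation (g δ) :=
    IsWIC.inflation_of_comp (g δ) f (by rw [hgf]; exact ⟨_, _, _, hf'⟩)
  have := (hg δ).2 hinfl (hg δ).1
  rw [← hgf]
  exact IsConflation.of_iso_left ⟨_, hf⟩ (asIso (g δ))

theorem PreservesConflations.map_isInflation {F : A ⥤ B} (hF : PreservesConflations F) {X Y : A}
    {f : X ⟶ Y} (hf : IsInflation f) : IsInflation (F.map f) :=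
  let ⟨_, _, h⟩ := hf
  ⟨_, _, hF _ _ h⟩

/-- A left adjoint of a functor preserving conflations preserves projective objects. -/
theorem IsProjective.map_of_adjunction {L : B ⥤ A} {R : A ⥤ B} (adj : L ⊣ R)
    (hR : PreservesConflations R) {P : B} (hP : IsProjective P) : IsProjective (L.obj P) := by
  intro X Y Z x y h f
  obtain ⟨g, hg⟩ := hP _ _ (hR x y h) (adj.homEquiv _ _ f)
  refine ⟨(adj.homEquiv _ _).symm g, ?_⟩
  rw [← adj.homEquiv_naturality_right_symm, hg, Equiv.symm_apply_apply]

/-- Applying `L` to a realization of `δ` gives, up to the invertible counit, a split conflation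
starting at `Y`; the adjunct of its retraction splits `δ`. -/
theorem ext_eq_zero_of_adjunction {L : B ⥤ A} {R : A ⥤ B} (adj : L ⊣ R)
    (hL : PreservesConflations L) [R.Full] [R.Faithful] {Z : B} {Y : A}
    (h : ∀ δ : Ext1 (L.obj Z) Y, δ = 0) (δ : Ext1 Z (R.obj Y)) : δ = 0 := by
  obtain ⟨M, x, y, hxy⟩ := ExtriangulatedCategory.exists_realizes δ
  obtain ⟨ε, hε⟩ := (hL x y ⟨δ, hxy⟩).of_iso_left (asIso (adj.counit.app Y)).symm
  obtain ⟨r, hr⟩ := hε.exists_desc_of_push_eq_zero (𝟙 Y) (by rw [h ε, push_zero])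
  have hr' : L.map x ≫ r = adj.counit.app Y := by simpa using hr
  refine IsETriangle.eq_zero_of_retraction hxy (adj.homEquiv _ _ r) ?_
  rw [← adj.homEquiv_naturality_left, hr', Adjunction.homEquiv_unit]
  simp

/-- `L` preserves projectives and conflations, so it takes a syzygy of `X` to a syzygy of `L X`. -/
theorem ExtVanishAt.of_adjunction [HasEnoughProjectives A] [HasEnoughProjectives B] {L : B ⥤ A}
    {R : A ⥤ B} (adj : L ⊣ R) (hL : PreservesConflations L) (hR : PreservesConflations R)
    [R.Full] [R.Faithful] {Y : A} {n : ℕ} :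
    ∀ {X : B}, ExtVanishAt Y n (L.obj X) → ExtVanishAt (R.obj Y) n X := by
  induction n with
  | zero => exact fun h => ext_eq_zero_of_adjunction adj hL h
  | succ n ih =>
    intro X h
    obtain ⟨K, P, k, p, hP, hkp⟩ := exists_syzygy X
    exact ⟨K, P, k, p, hP, hkp,
      ih (h.of_conflation (hP.map_of_adjunction adj hR) (hL _ _ hkp))⟩

theorem ExtVanish.of_adjunction [HasEnoughProjectives A] [HasEnoughProjectives B] {L : B ⥤ A}
    {R : A ⥤ B} (adj : L ⊣ R) (hL : PreservesConflations L) (hR : PreservesConflations R)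
    [R.Full] [R.Faithful] {X : B} {Y : A} (h : ExtVanish (L.obj X) Y) :
    ExtVanish X (R.obj Y) := by
  rw [extVanish_iff] at h ⊢
  exact fun n => (h n).of_adjunction adj hL hR

/-- If `x : X ⟶ Y` and `y : Y ⟶ Z` form a split conflation, then extensions by `Y` vanish as soon
as extensions by `X` and by `Z` do. -/
theorem ExtVanish.of_split [HasEnoughProjectives B] {T X Y Z : B} {x : X ⟶ Y} {y : Y ⟶ Z}
    (h : IsConflation x y) {s : Z ⟶ Y} (hs : s ≫ y = 𝟙 Z) (hX : ExtVanish T X)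
    (hZ : ExtVanish T Z) : ExtVanish T Y := by
  intro n δ
  obtain ⟨ε, hε⟩ := h
  obtain ⟨r, hr⟩ := hε.exists_lift (𝟙 Y - y ≫ s) (by simp [hs])
  have hid : 𝟙 Y = r ≫ x + y ≫ s := by rw [hr, sub_add_cancel]
  rw [← push_id δ, hid, add_push, push_comp, push_comp, hX n (push r δ), hZ n (push y δ),
    push_zero, push_zero, add_zero]

end Functors

/-- An additive functor vanishing on `Y` sends `X ⊕ Y` to its value at `X`. -/
noncomputable def mapBiprodIsoOfIsZeroRight {A : Type u₁} [Category.{v₁} A] [Preadditive A]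
    {B : Type u₂} [Category.{v₂} B] [Preadditive B] [HasBinaryBiproducts B] (F : B ⥤ A)
    [F.Additive] {X Y : B} (hY : IsZero (F.obj Y)) : F.obj (X ⊞ Y) ≅ F.obj X where
  hom := F.map biprod.fst
  inv := F.map biprod.inl
  hom_inv_id := by
    have h := congrArg F.map (biprod.total (X := X) (Y := Y))
    rw [F.map_add, F.map_comp biprod.snd, hY.eq_of_src (F.map biprod.inr) 0, comp_zero,
      add_zero] at h
    rw [← F.map_comp, h, F.map_id]
  inv_hom_id := by rw [← F.map_comp, biprod.inl_fst, F.map_id]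

/-- An additive functor vanishing on `X` sends `X ⊕ Y` to its value at `Y`. -/
noncomputable def mapBiprodIsoOfIsZeroLeft {A : Type u₁} [Category.{v₁} A] [Preadditive A]
    {B : Type u₂} [Category.{v₂} B] [Preadditive B] [HasBinaryBiproducts B] (F : B ⥤ A)
    [F.Additive] {X Y : B} (hX : IsZero (F.obj X)) : F.obj (X ⊞ Y) ≅ F.obj Y where
  hom := F.map biprod.snd
  inv := F.map biprod.inr
  hom_inv_id := by
    have h := congrArg F.map (biprod.total (X := X) (Y := Y))
    rw [F.map_add, F.map_comp biprod.fst, hX.eq_of_src (F.map biprod.inl) 0, comp_zero,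
      zero_add] at h
    rw [← F.map_comp, h, F.map_id]
  inv_hom_id := by rw [← F.map_comp, biprod.inr_snd, F.map_id]

/-! ### Splitting of the recollement. -/

namespace Recollement

variable {A : Type u₁} [Category.{v₁} A] [Preadditive A] [HasZeroObject A]
  [HasBinaryBiproducts A] [ExtriangulatedCategory.{w₁} A]
  {B : Type u₂} [Category.{v₂} B] [Preadditive B] [HasZeroObject B]
  [HasBinaryBiproducts B] [ExtriangulatedCategory.{w₂} B]
  {C : Type u₃} [Category.{v₃} C] [Preadditive C] [HasZeroObject C]
  [HasBinaryBiproducts C] [ExtriangulatedCategory.{w₃} C]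
  (R : Recollement A B C)

instance : R.iLowerStar.Full := R.iLowerStar_full
instance : R.iLowerStar.Faithful := R.iLowerStar_faithful
instance : R.jLowerShriek.Full := R.jLowerShriek_full
instance : R.jLowerShriek.Faithful := R.jLowerShriek_faithful
instance : R.jLowerStar.Full := R.jLowerStar_full
instance : R.jLowerStar.Faithful := R.jLowerStar_faithful
instance : R.iLowerStar.Additive := R.iLowerStar_exact.rightExact.additive
instance : R.jUpperStar.Additive := R.jUpperStar_exact.rightExact.additive
instance : R.iUpperStar.Additive := R.iUpperStar_rightExact.additive
instance : R.jLowerShriek.Additive := R.jLowerShriek_rightExact.additive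
instance : R.iUpperShriek.Additive := R.iUpperShriek_leftExact.additive
instance : R.jLowerStar.Additive := R.jLowerStar_leftExact.additive

theorem isZero_jUpperStar_iLowerStar (X : A) : IsZero (R.jUpperStar.obj (R.iLowerStar.obj X)) :=
  (R.essImage_eq_ker _).1 (R.iLowerStar.obj_mem_essImage X)

theorem isZero_iUpperShriek_jLowerStar (U : C) :
    IsZero (R.iUpperShriek.obj (R.jLowerStar.obj U)) := by
  rw [IsZero.iff_id_eq_zero]
  apply (R.adjI₂.homEquiv _ _).symm.injective
  apply (R.adjJ₂.homEquiv _ _).symm.injective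
  exact (R.isZero_jUpperStar_iLowerStar _).eq_of_src _ _

theorem isZero_iUpperStar_jLowerShriek (U : C) :
    IsZero (R.iUpperStar.obj (R.jLowerShriek.obj U)) := by
  rw [IsZero.iff_id_eq_zero]
  apply (R.adjI₁.homEquiv _ _).injective
  apply (R.adjJ₁.homEquiv _ _).injective
  exact (R.isZero_jUpperStar_iLowerStar _).eq_of_tgt _ _

/-- Applying `i^!` makes `θ_X` invertible, so `i^! K = 0`; with `i^! j_* = 0` this gives `A' ≅ i^!
i_* A' = 0`, and `y₂` is invertible. -/
theorem isConflation_counit_unit (h : PreservesConflations R.iUpperShriek) (X : B) :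
    IsConflation (R.adjI₂.counit.app X : R.iLowerStar.obj (R.iUpperShriek.obj X) ⟶ X)
      (R.adjJ₂.unit.app X : X ⟶ R.jLowerStar.obj (R.jUpperStar.obj X)) := by
  obtain ⟨A', z, K, y₁, y₂, h₁, h₂, hy, -⟩ := R.left_sequence X
  have hK : IsZero (R.iUpperShriek.obj K) := (h _ _ h₁).isZero_right inferInstance
  have hA : IsZero (R.iUpperShriek.obj (R.iLowerStar.obj A')) := by
    refine (h _ _ h₂).isZero_right ⟨0, hK.eq_of_src _ _, ?_⟩
    exact (R.isZero_iUpperShriek_jLowerStar _).eq_of_src _ _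
  have hA' : IsZero A' := hA.of_iso (asIso (R.adjI₂.unit.app A'))
  have := h₂.isIso_left (R.iLowerStar.map_isZero hA')
  have := h₁.of_iso_right (asIso y₂)
  rwa [asIso_hom, hy] at this

theorem isConflation_counit_unit' (h : PreservesConflations R.iUpperStar) (X : B) :
    IsConflation (R.adjJ₁.counit.app X : R.jLowerShriek.obj (R.jUpperStar.obj X) ⟶ X)
      (R.adjI₁.unit.app X : X ⟶ R.iLowerStar.obj (R.iUpperStar.obj X)) := by
  obtain ⟨A', z, K, y₁, y₂, h₁, h₂, hy, -⟩ := R.right_sequence X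
  have hK : IsZero (R.iUpperStar.obj K) := (h _ _ h₂).isZero_left inferInstance
  have hA : IsZero (R.iUpperStar.obj (R.iLowerStar.obj A')) := by
    refine (h _ _ h₁).isZero_left ⟨0, ?_, hK.eq_of_src _ _⟩
    exact (R.isZero_iUpperStar_jLowerShriek _).eq_of_src _ _
  have hA' : IsZero A' := hA.of_iso (asIso (R.adjI₁.counit.app A')).symm
  have := h₁.isIso_right (R.iLowerStar.map_isZero hA')
  have := h₂.of_iso_left (asIso y₁)
  rwa [asIso_hom, hy] at this

theorem isZero_of_isZero (h : PreservesConflations R.iUpperShriek) {X : B}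
    (h₁ : IsZero (R.iUpperShriek.obj X)) (h₂ : IsZero (R.jUpperStar.obj X)) : IsZero X := by
  have := (R.isConflation_counit_unit h X).isIso_right (R.iLowerStar.map_isZero h₁)
  exact (R.jLowerStar.map_isZero h₂).of_iso (asIso (R.adjJ₂.unit.app X))

/-- Left exactness leaves a compatible inflation `g δ` from `Z' δ` to `j_* Z`, whose cokernel term
`Q` has to vanish. Here `i^! Q = 0` because `i^! j_* = 0`. Also `j^* (g δ)` is an inflation, a
deflation by (WIC) because `j^* j_* y ≅ y`, and compatible, so `j^* Q = 0`. -/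
theorem jLowerStar_preservesConflations [IsWIC C] (h : PreservesConflations R.iUpperShriek)
    (hj : PreservesConflations R.jUpperStar) : PreservesConflations R.jLowerStar := by
  rintro X Y Z x y ⟨δ, hδ⟩
  obtain ⟨Z', g, η, hg, hη, -⟩ := R.jLowerStar_leftExact.exists_natural
  obtain ⟨f, hf, hfg⟩ := hη x y δ hδ
  obtain ⟨⟨Q, q, hQ⟩, hcomp⟩ := hg δ
  have hZ' : IsZero (R.iUpperShriek.obj (Z' δ)) :=
    (h _ _ ⟨_, hf⟩).isZero_right
      ⟨0, (R.isZero_iUpperShriek_jLowerStar _).eq_of_src _ _,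
        (R.isZero_iUpperShriek_jLowerStar _).eq_of_src _ _⟩
  have hQ₁ : IsZero (R.iUpperShriek.obj Q) :=
    (h _ _ hQ).isZero_right
      ⟨0, hZ'.eq_of_src _ _, (R.isZero_iUpperShriek_jLowerStar _).eq_of_src _ _⟩
  have hdefl : IsDeflation (R.jUpperStar.map (g δ)) := by
    apply IsWIC.deflation_of_comp (R.jUpperStar.map f)
    rw [← R.jUpperStar.map_comp, hfg]
    have hy : IsDeflation (R.adjJ₂.counit.app Y ≫ y) :=
      IsDeflation.iso_comp ⟨X, x, δ, hδ⟩ (asIso (R.adjJ₂.counit.app Y))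
    have heq : R.jUpperStar.map (R.jLowerStar.map y) =
        (R.adjJ₂.counit.app Y ≫ y) ≫ (asIso (R.adjJ₂.counit.app Z)).symm.hom :=
      (IsIso.eq_comp_inv _).2 (R.adjJ₂.counit_naturality y)
    rw [heq]
    exact hy.comp_iso _
  have hiso : IsIso (R.jUpperStar.map (g δ)) :=
    R.jUpperStar_exact.leftExact.map_compatible _ hcomp (hj.map_isInflation ⟨Q, q, hQ⟩) hdefl
  have hQ₂ : IsZero (R.jUpperStar.obj Q) := (hj _ _ hQ).isZero_right hiso
  have := hQ.isIso_left (R.isZero_of_isZero h hQ₁ hQ₂)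
  have := IsConflation.of_iso_right ⟨_, hf⟩ (asIso (g δ))
  rwa [asIso_hom, hfg] at this

section Compatible

variable (hR : R.IsThetaNuCompatible) (hShriek : PreservesConflations R.iUpperShriek)
  (hStar : PreservesConflations R.iUpperStar) (hj : PreservesConflations R.jUpperStar)
include hR hShriek hStar hj

/-- An object `j_! V` with `j_! V ⟶ 0` an inflation is zero. -/
theorem isZero_jLowerShriek_of_isInflation [IsWIC C] (V : C)
    (hV : IsInflation (0 : R.jLowerShriek.obj V ⟶ 0)) : IsZero (R.jLowerShriek.obj V) := by
  obtain ⟨T, t, hT⟩ := hV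
  have hiT : IsZero (R.iUpperStar.obj T) :=
    (hStar _ _ hT).isZero_right
      ⟨0, (R.isZero_iUpperStar_jLowerShriek V).eq_of_src _ _,
        (R.iUpperStar.map_isZero (isZero_zero B)).eq_of_src _ _⟩
  have hjT := R.jLowerStar_preservesConflations hShriek hj _ _ (hj _ _ hT)
  obtain ⟨δ₁, h₁⟩ := hjT
  obtain ⟨δ₂, h₂⟩ := R.isConflation_counit_unit hShriek T
  -- Over `j_* j^* T`, the pullback of `T` and the zero object `j_* j^* 0` is `i_* i^! T` up to
  -- isomorphism. This exhibits `θ_T` as a deflation as well as an inflation, so compatibility makes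
  -- it invertible.
  obtain ⟨M, m₁, e₁, m₂, e₂, hM₁, hM₂, -, hm⟩ := h₁.exists_homotopy_pullback h₂
  have := hM₂.isIso_left (R.jLowerStar.map_isZero (R.jUpperStar.map_isZero (isZero_zero B)))
  have hdefl : IsDeflation (R.adjI₂.counit.app T) := by
    rw [← hm]
    exact IsDeflation.iso_comp ⟨_, _, hM₁⟩ (asIso m₂)
  have hiso := (hR T).1 ⟨_, _, _, h₂⟩ hdefl
  have hjT : IsZero (R.jUpperStar.obj T) :=
    (R.isZero_jUpperStar_iLowerStar _).of_iso
      (R.jUpperStar.mapIso (asIso (R.adjI₂.counit.app T))).symm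
  have := (R.isConflation_counit_unit' hStar T).isIso_left (R.iLowerStar.map_isZero hiT)
  have hT0 : IsZero T :=
    (R.jLowerShriek.map_isZero hjT).of_iso (asIso (R.adjJ₁.counit.app T)).symm
  have := hT.isIso_left hT0
  exact (isZero_zero B).of_iso (asIso (0 : R.jLowerShriek.obj V ⟶ 0))

theorem isZero_iUpperShriek_jLowerShriek [IsWIC C] (V : C) :
    IsZero (R.iUpperShriek.obj (R.jLowerShriek.obj V)) := by
  -- If `j_! V ⟶ 0` is not an inflation it is vacuously compatible, hence so is its image under
  -- `i^!`, and that image turns out to be both an inflation and a deflation.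
  by_cases hV : IsInflation (0 : R.jLowerShriek.obj V ⟶ 0)
  · exact R.iUpperShriek.map_isZero
      (R.isZero_jLowerShriek_of_isInflation hR hShriek hStar hj V hV)
  have hcomp : IsCompatible (R.iUpperShriek.map (0 : R.jLowerShriek.obj V ⟶ 0)) :=
    R.iUpperShriek_leftExact.map_compatible _ fun h => absurd h hV
  have hzero : IsZero (R.iUpperShriek.obj (0 : B)) := R.iUpperShriek.map_isZero (isZero_zero B)
  have hzero' := R.isZero_iUpperShriek_jLowerStar V
  have hinfl : IsInflation (R.iUpperShriek.map (0 : R.jLowerShriek.obj V ⟶ 0)) := by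
    -- `i^!` of the inflation `j_! j^* j_* V ⟶ j_* V` has zero target and source isomorphic to `i^!
    -- j_! V`.
    have h₁ := hShriek.map_isInflation
      ⟨_, _, R.isConflation_counit_unit' hStar (R.jLowerStar.obj V)⟩
    have h₂ := (h₁.comp_iso (hzero'.iso hzero)).iso_comp
      (R.iUpperShriek.mapIso (R.jLowerShriek.mapIso (asIso (R.adjJ₂.counit.app V)))).symm
    rwa [hzero.eq_of_tgt (R.iUpperShriek.map (0 : R.jLowerShriek.obj V ⟶ 0)) _]
  have := hcomp hinfl (isDeflation_of_isZero hzero _)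
  exact hzero.of_iso (asIso (R.iUpperShriek.map (0 : R.jLowerShriek.obj V ⟶ 0)))

/-- `i^!` kills the first two terms of `j_! j^* j_* V ⟶ j_* V ⟶ i_* i^* j_* V`, hence the third. -/
theorem isZero_iUpperStar_jLowerStar [IsWIC C] (V : C) :
    IsZero (R.iUpperStar.obj (R.jLowerStar.obj V)) := by
  have h := hShriek _ _ (R.isConflation_counit_unit' hStar (R.jLowerStar.obj V))
  have hzero : IsZero (R.iUpperShriek.obj (R.iLowerStar.obj
      (R.iUpperStar.obj (R.jLowerStar.obj V)))) :=
    h.isZero_right ⟨0,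
      (R.isZero_iUpperShriek_jLowerShriek hR hShriek hStar hj _).eq_of_src _ _,
      (R.isZero_iUpperShriek_jLowerStar V).eq_of_src _ _⟩
  exact hzero.of_iso (asIso (R.adjI₂.unit.app _))

/-- By naturality, `j_! j^* X ⟶ X ⟶ j_* j^* X` is the unit at `j_! j^* X`, invertible since `i^! j_!
= 0`, followed by the isomorphism `j_* j^* υ_X`. -/
theorem exists_section_unit [IsWIC C] (X : B) :
    ∃ s : R.jLowerStar.obj (R.jUpperStar.obj X) ⟶ X, s ≫ R.adjJ₂.unit.app X = 𝟙 _ := by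
  have hiso : IsIso (R.adjJ₂.unit.app (R.jLowerShriek.obj (R.jUpperStar.obj X))) :=
    (R.isConflation_counit_unit hShriek _).isIso_right
      (R.iLowerStar.map_isZero
        (R.isZero_iUpperShriek_jLowerShriek hR hShriek hStar hj _))
  have hnat := R.adjJ₂.unit_naturality (R.adjJ₁.counit.app X)
  have : IsIso (R.adjJ₁.counit.app X ≫ R.adjJ₂.unit.app X) := by
    exact hnat ▸ inferInstanceAs (IsIso (R.adjJ₂.unit.app (R.jLowerShriek.obj (R.jUpperStar.obj X)) ≫
      R.jLowerStar.map (R.jUpperStar.map (R.adjJ₁.counit.app X))))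
  exact ⟨inv (R.adjJ₁.counit.app X ≫ R.adjJ₂.unit.app X) ≫ R.adjJ₁.counit.app X, by simp⟩

theorem nonempty_iso_biprod [IsWIC C] (X : B) :
    Nonempty (X ≅ R.iLowerStar.obj (R.iUpperShriek.obj X) ⊞
      R.jLowerStar.obj (R.jUpperStar.obj X)) := by
  obtain ⟨s, hs⟩ := R.exists_section_unit hR hShriek hStar hj X
  obtain ⟨δ, hδ⟩ := R.isConflation_counit_unit hShriek X
  obtain ⟨b, -⟩ := hδ.exists_iso_biprod (hδ.eq_zero_of_section s hs)
  exact ⟨b⟩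

theorem nonempty_iso_iUpperStar_iUpperShriek [IsWIC C] (X : B) :
    Nonempty (R.iUpperStar.obj X ≅ R.iUpperShriek.obj X) := by
  have h := hStar _ _ (R.isConflation_counit_unit hShriek X)
  have := h.isIso_left (R.isZero_iUpperStar_jLowerStar hR hShriek hStar hj _)
  exact ⟨(asIso (R.iUpperStar.map (R.adjI₂.counit.app X))).symm ≪≫
    asIso (R.adjI₁.counit.app (R.iUpperShriek.obj X))⟩

/-- `Y` splits into `i_* i^! Y` and `j_* j^* Y`, treated by `i^* ⊣ i_*` and `j^* ⊣ j_*`. The first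
adjunction involves `i^* X`, which `i^* ≅ i^!` replaces by `i^! X`. -/
theorem extVanish_of_extVanish [IsWIC C] [HasEnoughProjectives A] [HasEnoughProjectives B]
    [HasEnoughProjectives C] (hi : PreservesConflations R.iLowerStar) {X Y : B}
    (h₁ : ExtVanish (R.iUpperShriek.obj X) (R.iUpperShriek.obj Y))
    (h₂ : ExtVanish (R.jUpperStar.obj X) (R.jUpperStar.obj Y)) : ExtVanish X Y := by
  obtain ⟨s, hs⟩ := R.exists_section_unit hR hShriek hStar hj Y
  obtain ⟨e⟩ := R.nonempty_iso_iUpperStar_iUpperShriek hR hShriek hStar hj X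
  exact ExtVanish.of_split (R.isConflation_counit_unit hShriek Y) hs
    ((h₁.of_iso e.symm (Iso.refl _)).of_adjunction R.adjI₁ hStar hi)
    (h₂.of_adjunction R.adjJ₂ hj (R.jLowerStar_preservesConflations hShriek hj))

end Compatible

/-- `i^! (i_* X ⊕ j_* U) ≅ X`. -/
noncomputable def iUpperShriekBiprodIso (X : A) (U : C) :
    R.iUpperShriek.obj (R.iLowerStar.obj X ⊞ R.jLowerStar.obj U) ≅ X :=
  mapBiprodIsoOfIsZeroRight R.iUpperShriek (R.isZero_iUpperShriek_jLowerStar U) ≪≫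
    (asIso (R.adjI₂.unit.app X)).symm

/-- `j^* (i_* X ⊕ j_* U) ≅ U`. -/
noncomputable def jUpperStarBiprodIso (X : A) (U : C) :
    R.jUpperStar.obj (R.iLowerStar.obj X ⊞ R.jLowerStar.obj U) ≅ U :=
  mapBiprodIsoOfIsZeroLeft R.jUpperStar (R.isZero_jUpperStar_iLowerStar X) ≪≫
    asIso (R.adjJ₂.counit.app U)

end Recollement

theorem IsWakamatsuTilting.map_summand {A : Type u₁} [Category.{v₁} A] [Preadditive A]
    [HasZeroObject A] [HasBinaryBiproducts A] [ExtriangulatedCategory.{w₁} A]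
    [HasEnoughProjectives A] {B : Type u₂} [Category.{v₂} B] [Preadditive B]
    [HasBinaryBiproducts B] {T : ObjectProperty A} (hT : IsWakamatsuTilting T) (F : B ⥤ A)
    [F.Additive] {X Y : B} (h : T (F.obj (X ⊞ Y))) : T (F.obj X) :=
  have := preservesBinaryBiproducts_of_preservesBiproducts F
  hT.closed_summand _ (F.obj Y) (hT.closed_iso (F.mapBiprod X Y) h)

end Extri

theorem theorem4p6
    {A : Type u₁} [Category.{v₁} A] [Preadditive A] [HasZeroObject A] [HasBinaryBiproducts A]
    [Extri.ExtriangulatedCategory.{w₁} A] [Extri.HasEnoughProjectives A]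
    [Extri.HasEnoughInjectives A] [Extri.IsWIC A]
    {B : Type u₂} [Category.{v₂} B] [Preadditive B] [HasZeroObject B] [HasBinaryBiproducts B]
    [Extri.ExtriangulatedCategory.{w₂} B] [Extri.HasEnoughProjectives B]
    [Extri.HasEnoughInjectives B] [Extri.IsWIC B]
    {C : Type u₃} [Category.{v₃} C] [Preadditive C] [HasZeroObject C] [HasBinaryBiproducts C]
    [Extri.ExtriangulatedCategory.{w₃} C] [Extri.HasEnoughProjectives C]
    [Extri.HasEnoughInjectives C] [Extri.IsWIC C]
    (R : Extri.Recollement A B C) (hR : R.IsThetaNuCompatible)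
    (hiShriek : Extri.IsExactFunctor R.iUpperShriek)
    (hiStar : Extri.IsExactFunctor R.iUpperStar)
    (X' : ObjectProperty A) (X'' : ObjectProperty C)
    (hX' : Extri.IsWakamatsuTilting X') (hX'' : Extri.IsWakamatsuTilting X'') :
    Extri.IsWakamatsuTilting (R.glue X' X'') := by
  have hShriek := hiShriek.preservesConflations
  have hStar := hiStar.preservesConflations
  have hi := R.iLowerStar_exact.preservesConflations
  have hj := R.jUpperStar_exact.preservesConflations
  have hj' := R.jLowerStar_preservesConflations hShriek hj
  refine ⟨?_, ?_, ?_, ?_⟩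
  · exact fun e h => ⟨hX'.closed_iso (R.iUpperShriek.mapIso e) h.1,
      hX''.closed_iso (R.jUpperStar.mapIso e) h.2⟩
  · exact fun X Y h => ⟨hX'.map_summand R.iUpperShriek h.1, hX''.map_summand R.jUpperStar h.2⟩
  · exact fun X Y hX hY => R.extVanish_of_extVanish hR hShriek hStar hj hi
      (hX'.self_orthogonal _ _ hX.1 hY.1) (hX''.self_orthogonal _ _ hX.2 hY.2)
  · intro P hP
    obtain ⟨e⟩ := R.nonempty_iso_biprod hR hShriek hStar hj P
    obtain ⟨e'⟩ := R.nonempty_iso_iUpperStar_iUpperShriek hR hShriek hStar hj P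
    obtain ⟨K', T', g', f', hK0', hgf', hK', hT'⟩ := hX'.projective_coresolved _
      -- Projectivity is inherited by `i^* P`, as `i^*` is a left adjoint, and carried to `i^! P` by
      -- `i^* ≅ i^!`.
      (Extri.IsProjective.of_iso (Extri.IsProjective.map_of_adjunction R.adjI₁ hi hP) e')
    obtain ⟨K'', T'', g'', f'', hK0'', hgf'', hK'', hT''⟩ := hX''.projective_coresolved _
      (Extri.IsProjective.map_of_adjunction R.adjJ₂ hj' hP)
    refine Extri.coresolvedBy.of_iso ⟨fun n => R.iLowerStar.obj (K' n) ⊞ R.jLowerStar.obj (K'' n),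
      fun n => R.iLowerStar.obj (T' n) ⊞ R.jLowerStar.obj (T'' n),
      fun n => biprod.map (R.iLowerStar.map (g' n)) (R.jLowerStar.map (g'' n)),
      fun n => biprod.map (R.iLowerStar.map (f' n)) (R.jLowerStar.map (f'' n)),
      by simp only [hK0', hK0''], fun n => (hi _ _ (hgf' n)).biprod (hj' _ _ (hgf'' n)), ?_, ?_⟩ e.symm
    -- `i^!` and `j^*` recover the two summands of `i_* K' ⊕ j_* K''`, so orthogonality is checked
    -- in `A` and `C` separately.
    · exact fun n Y hY => R.extVanish_of_extVanish hR hShriek hStar hj hi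
        ((hK' n _ hY.1).of_iso (R.iUpperShriekBiprodIso _ _).symm (Iso.refl _))
        ((hK'' n _ hY.2).of_iso (R.jUpperStarBiprodIso _ _).symm (Iso.refl _))
    · exact fun n => ⟨hX'.closed_iso (R.iUpperShriekBiprodIso _ _).symm (hT' n),
        hX''.closed_iso (R.jUpperStarBiprodIso _ _).symm (hT'' n)⟩
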